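/- Theorem 5.3. Arithmetic circuits over $\mathbb{C}$ (straight-line programs) use the operations $+,-,\times$; each operation, including multiplication by a constant, costs one, while inputs and constants of $\mathbb{C}$ are free. Let $\omega$ be the exponent of matrix multiplication, i.e. the infimum of all real $\tau$ for which there is a constant $b$ such that for every $n\ge 1$ two $n\times n$ complex matrices can be multiplied by an arithmetic circuit with at most $b\,n^{\tau}$ operations. For a finite group $G$ and a complete set $\mathrm{Irr}(G)$ of pairwise inequivalent irreducible complex matrix representations of $G$, the generalized DFT of $G$ with respect to $\mathrm{Irr}(G)$ is the linear map $$c=(c_g)_{g\in G}\in\mathbb{C}[G]\ \longmapsto\ \sum_{g\in G}c_g\bigoplus_{\rho\in\mathrm{Irr}(G)}\rho(g),$$ whose output consists of the $\sum_{\rho}\dim(\rho)^2$ entries of the diagonal blocks. For every $\varepsilon>0$ there is a constant $c_\varepsilon$, depending only on $\varepsilon$, such that for every $n\ge 0$ and every prime power $q$ the following holds for $G=\mathrm{GL}_n(\mathbb{F}_q)$: a complete set of irreducible complex matrix representations of $G$ exists, and for every such set $\mathrm{Irr}(G)$ the generalized DFT of $G$ with respect to $\mathrm{Irr}(G)$ is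 computed by an arithmetic circuit with at most $c_\varepsilon\,|G|^{\omega/2+\varepsilon}$ operations. -/

import Mathlib

noncomputable section

namespace GenDFT

/-! ### Arithmetic circuits (straight-line programs) and their operation count -/

/-- What an operation may refer to when `m` operations have been performed so far:
an input variable, a constant of the field, or the result of an earlier operation. -/
inductive Operand (K : Type) (X : Type) (m : ℕ) : Type
  | input (x : X) : Operand K X m
  | const (a : K) : Operand K X m
  | result (j : Fin m) : Operand K X m

/-- One arithmetic operation. -/
inductive Gate (K : Type) (X : Type) (m : ℕ) : Type
  | add (u v : Operand K X m) : Gate K X m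
  | sub (u v : Operand K X m) : Gate K X m
  | mul (u v : Operand K X m) : Gate K X m

/-- A straight-line program consisting of a given number of operations, each of which may use
the inputs, constants and the results of all operations before it. -/
inductive SLP (K : Type) (X : Type) : ℕ → Type
  | nil : SLP K X 0
  | snoc {m : ℕ} (P : SLP K X m) (g : Gate K X m) : SLP K X (m + 1)

variable {K : Type} [Field K] {X Y : Type}

/-- The value of an operand, for given values `x` of the inputs and `r` of the earlier results. -/
def Operand.eval {m : ℕ} (x : X → K) (r : Fin m → K) : Operand K X m → K
  | .input i => x i
  | .const a => a
  | .result j => r j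

/-- The value of an operation. -/
def Gate.eval {m : ℕ} (x : X → K) (r : Fin m → K) : Gate K X m → K
  | .add u v => u.eval x r + v.eval x r
  | .sub u v => u.eval x r - v.eval x r
  | .mul u v => u.eval x r * v.eval x r

/-- The results of all operations of a straight-line program on the input `x`. -/
def SLP.eval (x : X → K) : {m : ℕ} → SLP K X m → Fin m → K
  | _, .nil => Fin.elim0
  | _, .snoc P g => Fin.snoc (α := fun _ => K) (P.eval x) (g.eval x (P.eval x))

/-- An arithmetic circuit over `K` with inputs indexed by `X` and outputs indexed by `Y`.
Its `size` is the number of arithmetic operations (additions, subtractions and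
multiplications, including multiplications by constants) that it performs. -/
structure Circuit (K : Type) (X Y : Type) where
  size : ℕ
  prog : SLP K X size
  out : Y → Operand K X size

/-- The outputs of the circuit on the input `x`. -/
def Circuit.eval (C : Circuit K X Y) (x : X → K) (y : Y) : K :=
  (C.out y).eval x (C.prog.eval x)

/-- The circuit computes the map `f`. -/
def Circuit.Computes (C : Circuit K X Y) (f : (X → K) → (Y → K)) : Prop :=
  ∀ x, C.eval x = f x

/-! ### The exponent of matrix multiplication -/

/-- Multiplication of two `n × n` matrices, as a map from the `2 n ^ 2` entries of the factors
to the `n ^ 2` entries of the product. -/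
def matMul (n : ℕ) (x : (Fin n × Fin n) ⊕ (Fin n × Fin n) → ℂ) (p : Fin n × Fin n) : ℂ :=
  ((Matrix.of fun i j => x (Sum.inl (i, j))) * (Matrix.of fun i j => x (Sum.inr (i, j)))) p.1 p.2

/-- There is a constant `b` such that, for every `n`, two `n × n` complex matrices can be
multiplied with at most `b * n ^ τ` arithmetic operations. -/
def IsMatMulExponent (τ : ℝ) : Prop :=
  ∃ b : ℝ, ∀ n : ℕ, 1 ≤ n →
    ∃ C : Circuit ℂ ((Fin n × Fin n) ⊕ (Fin n × Fin n)) (Fin n × Fin n),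
      C.Computes (matMul n) ∧ (C.size : ℝ) ≤ b * (n : ℝ) ^ τ

/-- The exponent `ω` of matrix multiplication. -/
def omega : ℝ := sInf {τ : ℝ | IsMatMulExponent τ}

/-! ### Complete sets of irreducible representations and the generalized DFT -/

/-- The representation on `ℂ ^ d` given by a matrix representation. -/
def toRep {G : Type} [Group G] {d : ℕ} (ρ : G →* Matrix (Fin d) (Fin d) ℂ) :
    Representation ℂ G (Fin d → ℂ) :=
  ((Matrix.toLinAlgEquiv' : Matrix (Fin d) (Fin d) ℂ ≃ₐ[ℂ] _) : _ →* _).comp ρ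

/-- The family `ρ` of matrix representations (so, with bases chosen) is a complete set of
irreducible complex representations of `G`: every member is irreducible, distinct members are
inequivalent, and every irreducible representation is equivalent to a member. -/
structure IsCompleteIrreps {G : Type} [Group G] {ι : Type} {d : ι → ℕ}
    (ρ : ∀ i, G →* Matrix (Fin (d i)) (Fin (d i)) ℂ) : Prop where
  irreducible : ∀ i, (toRep (ρ i)).IsIrreducible
  inequivalent : ∀ i j, Nonempty ((toRep (ρ i)).Equiv (toRep (ρ j))) → i = j
  complete : ∀ (m : ℕ) (σ : G →* Matrix (Fin m) (Fin m) ℂ), (toRep σ).IsIrreducible →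
    ∃ i, Nonempty ((toRep σ).Equiv (toRep (ρ i)))

/-- The generalized DFT of `G` with respect to the family `ρ`: it sends `c`, an element of the
group algebra given by its coefficients, to `∑ g, c g • ⨁ i, ρ i g`. The output is the family of
all entries of the diagonal blocks. -/
def dft {G : Type} [Group G] [Fintype G] {ι : Type} {d : ι → ℕ}
    (ρ : ∀ i, G →* Matrix (Fin (d i)) (Fin (d i)) ℂ) (c : G → ℂ)
    (p : Σ i, Fin (d i) × Fin (d i)) : ℂ :=
  (∑ g, c g • ρ p.1 g) p.2.1 p.2.2

end GenDFT

end

/-!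
The transform is computed by a reduction to two subgroups. Let a finite group `G` be covered by the
sets `H s K`, for subgroups `H`, `K` and `s` in a set `W`. An element of `ℂ[G]` is a sum of `|W|`
parts, each of which is supported on one set `H s K` and can be pulled back to `H × K`. Transforming
such a part along `H` and then along `K` takes `|K|` transforms of `H` and at most `|H|` transforms
of `K`. Now restrict the irreducible representations `ρ` of `G` to `H` and to `K`, and write `ρ` with
rows in a basis adapted to `H` and columns in a basis adapted to `K`. The block that belongs to
irreducible representations `σ` of `H` and `τ` of `K`, of degrees `e` and `f`, depends linearly on the
`σ ⊗ τ`-component of the transform of `H × K`, so that for each pair `(σ, τ)` there remains one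
product of an `ef × ef` matrix with a fixed matrix. The number of its columns is the number of
simultaneous occurrences of `σ` and `τ` in the `ρ`, which is at most `|W| e f` (`Splitting.card_le`):
the matrix coefficients of the `ρ` are linearly independent, and by equivariance they are determined
by their values on `W`. Since `∑ e ^ 2 ≤ |H|` and `∑ f ^ 2 ≤ |K|`, and exponents `t` of matrix
multiplication satisfy `t ≥ 2`, the products take `O(|W| (|H| |K|) ^ (t / 2))` operations for each
part, and the return to arbitrary bases takes `O(|G| ^ (t / 2))` operations
(`MatMulBound.dftCost_of_cover`).

For `G = GL_n(F)` take the unitriangular group for `H`, the Borel subgroup of upper triangular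
matrices for `K`, and permutation matrices for `W` (`exists_bruhat`). Then `|H| |K| ≤ |G|`, and
`|W| ≤ n ^ n` is, up to a constant, smaller than any power of `|G| ≥ 2 ^ (n (n - 1))`. It remains to
transform along `H` and `K`. Both groups are built up from cyclic groups by products `G = H K` with `H ∩ K = 1`, where
the reduction applies with `|W| = 1`; in each such step the cost relative to `|G| ^ (t / 2)` grows
by an additive constant, which leads to a factor `O(log |G|)` (`MatMulBound.dftBound_of_bijective`).
For cyclic groups of arbitrary order there is the method of Bluestein (`cost_chirp`).

Operation counts are handled by the predicate `Cost`, which speaks about functions of the input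
instead of programs, and is translated to circuits at the end (`Cost.exists_circuit`).
-/

namespace GenDFT

/-! ### Counting operations on functions of the input -/

section Derives

variable {Ω : Type}

/-- `Derives A m B`: starting from the set `A` of complex functions on `Ω`, performing `m`
arithmetic operations, each on functions that are already available, makes exactly the functions
in `B` available. This is a straight-line program with the syntax forgotten: only the set of
functions computed so far is recorded. -/
inductive Derives (A : Set (Ω → ℂ)) : ℕ → Set (Ω → ℂ) → Prop
  | refl : Derives A 0 A
  | add {m : ℕ} {B : Set (Ω → ℂ)} {u v : Ω → ℂ} :
      Derives A m B → u ∈ B → v ∈ B → Derives A (m + 1) (insert (u + v) B)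
  | sub {m : ℕ} {B : Set (Ω → ℂ)} {u v : Ω → ℂ} :
      Derives A m B → u ∈ B → v ∈ B → Derives A (m + 1) (insert (u - v) B)
  | mul {m : ℕ} {B : Set (Ω → ℂ)} {u v : Ω → ℂ} :
      Derives A m B → u ∈ B → v ∈ B → Derives A (m + 1) (insert (u * v) B)

theorem Derives.trans {A B C : Set (Ω → ℂ)} {m k : ℕ} (h : Derives A m B)
    (h' : Derives B k C) : Derives A (m + k) C := by
  induction h' with
  | refl => exact h
  | add _ hu hv ih => exact ih.add hu hv
  | sub _ hu hv ih => exact ih.sub hu hv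
  | mul _ hu hv ih => exact ih.mul hu hv

theorem Derives.union {A B : Set (Ω → ℂ)} {m : ℕ} (h : Derives A m B) (D : Set (Ω → ℂ)) :
    Derives (A ∪ D) m (B ∪ D) := by
  induction h with
  | refl => exact .refl
  | add _ hu hv ih => rw [Set.insert_union]; exact ih.add (.inl hu) (.inl hv)
  | sub _ hu hv ih => rw [Set.insert_union]; exact ih.sub (.inl hu) (.inl hv)
  | mul _ hu hv ih => rw [Set.insert_union]; exact ih.mul (.inl hu) (.inl hv)

theorem Derives.subset {A B : Set (Ω → ℂ)} {m : ℕ} (h : Derives A m B) : A ⊆ B := by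
  induction h with
  | refl => exact subset_rfl
  | add _ _ _ ih => exact ih.trans (Set.subset_insert _ _)
  | sub _ _ _ ih => exact ih.trans (Set.subset_insert _ _)
  | mul _ _ _ ih => exact ih.trans (Set.subset_insert _ _)

/-- `Obtains A s T`: all functions in `T` can be obtained from the functions in `A` with at most
`s` arithmetic operations. -/
def Obtains (A : Set (Ω → ℂ)) (s : ℝ) (T : Set (Ω → ℂ)) : Prop :=
  ∃ (m : ℕ) (B : Set (Ω → ℂ)), (m : ℝ) ≤ s ∧ Derives A m B ∧ T ⊆ B

theorem Obtains.mono {A A' T T' : Set (Ω → ℂ)} {s s' : ℝ} (h : Obtains A s T) (hA : A ⊆ A')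
    (hs : s ≤ s') (hT : T' ⊆ T) : Obtains A' s' T' := by
  obtain ⟨m, B, hm, hB, hTB⟩ := h
  refine ⟨m, B ∪ A', hm.trans hs, ?_, (hT.trans hTB).trans Set.subset_union_left⟩
  have := hB.union A'
  rwa [Set.union_eq_right.2 hA] at this

theorem Obtains.trans {A T U : Set (Ω → ℂ)} {s t : ℝ} (h : Obtains A s T)
    (h' : Obtains (A ∪ T) t U) : Obtains A (s + t) (T ∪ U) := by
  obtain ⟨m, B, hm, hB, hTB⟩ := h
  obtain ⟨k, C, hk, hC, hUC⟩ := h'.mono (A' := B) (Set.union_subset hB.subset hTB) le_rfl le_rfl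
  exact ⟨m + k, C, by push_cast; linarith, hB.trans hC,
    Set.union_subset (hTB.trans hC.subset) hUC⟩

theorem obtains_of_subset {A T : Set (Ω → ℂ)} (h : T ⊆ A) : Obtains A 0 T :=
  ⟨0, A, by simp, .refl, h⟩

theorem Obtains.iUnion {ι : Type*} [Fintype ι] {A : Set (Ω → ℂ)} {s : ι → ℝ}
    {T : ι → Set (Ω → ℂ)} (h : ∀ i, Obtains A (s i) (T i)) :
    Obtains A (∑ i, s i) (⋃ i, T i) := by
  classical
  suffices H : ∀ S : Finset ι, Obtains A (∑ i ∈ S, s i) (⋃ i ∈ S, T i) by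
    simpa using H Finset.univ
  intro S
  induction S using Finset.induction_on with
  | empty => simpa using obtains_of_subset (Set.empty_subset A)
  | insert a S ha ih =>
    rw [Finset.sum_insert ha, Finset.set_biUnion_insert]
    exact (h a).trans (ih.mono Set.subset_union_left le_rfl le_rfl)

theorem obtains_range_of_binary {Y : Type*} [Fintype Y] {A : Set (Ω → ℂ)} {w : Y → Ω → ℂ}
    (h : ∀ y, ∃ u ∈ A, ∃ v ∈ A, w y = u + v ∨ w y = u * v) :
    Obtains A (Fintype.card Y) (Set.range w) := by
  have : ∀ y, Obtains A 1 {w y} := by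
    intro y
    obtain ⟨u, hu, v, hv, h | h⟩ := h y
    · exact ⟨1, _, by simp, Derives.refl.add hu hv, by simp [h]⟩
    · exact ⟨1, _, by simp, Derives.refl.mul hu hv, by simp [h]⟩
  refine (Obtains.iUnion this).mono le_rfl (by simp) ?_
  simp

end Derives

/-! ### Cost of a map, and its relation to circuits -/

section Cost

variable {X Y Z : Type}

/-- `Cost f s`: the outputs of `f` can be obtained from its inputs and constants with at most `s`
arithmetic operations. The inputs may be arbitrary functions on some `Ω` (instead of just the
coordinate functions on `X → ℂ`), which makes substitution of computations immediate. -/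
def Cost (f : (X → ℂ) → Y → ℂ) (s : ℝ) : Prop :=
  ∀ (Ω : Type) (A : Set (Ω → ℂ)) (x : X → Ω → ℂ), (∀ a : ℂ, (fun _ => a) ∈ A) →
    (∀ i, x i ∈ A) → Obtains A s (Set.range fun y ω => f (fun i => x i ω) y)

theorem Cost.mono {f : (X → ℂ) → Y → ℂ} {s t : ℝ} (h : Cost f s) (hst : s ≤ t) : Cost f t :=
  fun Ω A x hc hx => (h Ω A x hc hx).mono le_rfl hst le_rfl

theorem Cost.comp {g : (Y → ℂ) → Z → ℂ} {f : (X → ℂ) → Y → ℂ} {s t : ℝ} (hg : Cost g t)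
    (hf : Cost f s) : Cost (fun x => g (f x)) (s + t) := by
  intro Ω A x hc hx
  refine ((hf Ω A x hc hx).trans (hg Ω _ (fun y ω => f (fun i => x i ω) y) (fun a => .inl (hc a))
    fun y => .inr ⟨y, rfl⟩)).mono le_rfl le_rfl Set.subset_union_right

/-- If every output of `g` is an output of some `f i`, then computing all `f i` computes `g`. -/
theorem Cost.of_family {ι : Type*} [Fintype ι] {Z : ι → Type} {f : ∀ i, (X → ℂ) → Z i → ℂ}
    {s : ι → ℝ} (hf : ∀ i, Cost (f i) (s i)) {g : (X → ℂ) → Y → ℂ}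
    (hg : ∀ y, ∃ i z, ∀ x, g x y = f i x z) : Cost g (∑ i, s i) := by
  intro Ω A x hc hx
  refine (Obtains.iUnion fun i => hf i Ω A x hc hx).mono le_rfl le_rfl ?_
  rintro _ ⟨y, rfl⟩
  obtain ⟨i, z, h⟩ := hg y
  exact Set.mem_iUnion.2 ⟨i, z, by simp [h]⟩

theorem Cost.reindex {f : (X → ℂ) → Y → ℂ} {s : ℝ} (hf : Cost f s) {g : (X → ℂ) → Z → ℂ}
    (hg : ∀ z, ∃ y, ∀ x, g x z = f x y) : Cost g s := by
  simpa using Cost.of_family (ι := Unit) (f := fun _ => f) (s := fun _ => s) (fun _ => hf)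
    (g := g) (by simpa using hg)

theorem Cost.free {f : (X → ℂ) → Y → ℂ}
    (h : ∀ y, (∃ i, ∀ x, f x y = x i) ∨ ∃ a, ∀ x, f x y = a) : Cost f 0 := by
  intro Ω A x hc hx
  refine obtains_of_subset ?_
  rintro _ ⟨y, rfl⟩
  obtain ⟨i, h⟩ | ⟨a, h⟩ := h y
  · simpa [h] using hx i
  · simpa [h] using hc a

theorem Cost.binary [Fintype Z] {f g : (X → ℂ) → Y → ℂ} {s t : ℝ} (hf : Cost f s)
    (hg : Cost g t) {k : (X → ℂ) → Z → ℂ}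
    (hk : ∀ z, ∃ y y', (∀ x, k x z = f x y + g x y') ∨ ∀ x, k x z = f x y * g x y') :
    Cost k (s + t + Fintype.card Z) := by
  intro Ω A x hc hx
  refine (((hf Ω A x hc hx).trans ((hg Ω A x hc hx).mono Set.subset_union_left le_rfl
    le_rfl)).trans (obtains_range_of_binary ?_)).mono le_rfl le_rfl Set.subset_union_right
  intro z
  obtain ⟨y, y', h⟩ := hk z
  refine ⟨_, .inr (.inl ⟨y, rfl⟩), _, .inr (.inr ⟨y', rfl⟩), ?_⟩
  refine h.imp (fun h => ?_) (fun h => ?_) <;> funext ω <;> simp [h]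

theorem Cost.add [Fintype Y] {f g : (X → ℂ) → Y → ℂ} {s t : ℝ} (hf : Cost f s)
    (hg : Cost g t) : Cost (fun x y => f x y + g x y) (s + t + Fintype.card Y) :=
  hf.binary hg fun y => ⟨y, y, .inl fun _ => rfl⟩

theorem Cost.mul [Fintype Y] {f g : (X → ℂ) → Y → ℂ} {s t : ℝ} (hf : Cost f s)
    (hg : Cost g t) : Cost (fun x y => f x y * g x y) (s + t + Fintype.card Y) :=
  hf.binary hg fun y => ⟨y, y, .inr fun _ => rfl⟩

theorem Cost.const_mul [Fintype Y] {f : (X → ℂ) → Y → ℂ} {s : ℝ} (hf : Cost f s) (a : Y → ℂ) :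
    Cost (fun x y => a y * f x y) (s + Fintype.card Y) := by
  have h : Cost (fun (_ : X → ℂ) => a) 0 := Cost.free fun y => .inr ⟨a y, fun _ => rfl⟩
  simpa using h.mul hf

theorem Cost.sum [Fintype Y] {ι : Type*} [Fintype ι] {f : ι → (X → ℂ) → Y → ℂ} {s : ι → ℝ}
    (hf : ∀ i, Cost (f i) (s i)) :
    Cost (fun x y => ∑ i, f i x y) (∑ i, (s i + Fintype.card Y)) := by
  classical
  suffices H : ∀ S : Finset ι, Cost (fun x y => ∑ i ∈ S, f i x y)
      (∑ i ∈ S, (s i + Fintype.card Y)) from H Finset.univ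
  intro S
  induction S using Finset.induction_on with
  | empty => simpa using Cost.free fun y => .inr ⟨0, fun _ => rfl⟩
  | insert a S ha ih =>
    simp only [Finset.sum_insert ha]
    exact ((hf a).add ih).mono (by linarith)

/-- The same operand, seen after one more operation has been performed. -/
def Operand.lift {K : Type} {m : ℕ} : Operand K X m → Operand K X (m + 1)
  | .input i => .input i
  | .const a => .const a
  | .result j => .result j.castSucc

theorem Operand.eval_lift {m : ℕ} (x : X → ℂ) (P : SLP ℂ X m) (g : Gate ℂ X m)
    (u : Operand ℂ X m) : u.lift.eval x ((P.snoc g).eval x) = u.eval x (P.eval x) := by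
  cases u <;> simp [Operand.lift, Operand.eval, SLP.eval]

theorem Operand.eval_last {m : ℕ} (x : X → ℂ) (P : SLP ℂ X m) (g : Gate ℂ X m) :
    (Operand.result (Fin.last m)).eval x ((P.snoc g).eval x) = g.eval x (P.eval x) := by
  simp [Operand.eval, SLP.eval]

theorem Derives.exists_slp {A B : Set ((X → ℂ) → ℂ)} {m : ℕ} (h : Derives A m B)
    (hA : ∀ f ∈ A, (∃ i, f = fun x => x i) ∨ ∃ a, f = fun _ => a) :
    ∃ P : SLP ℂ X m, ∀ f ∈ B, ∃ u : Operand ℂ X m, ∀ x, u.eval x (P.eval x) = f x := by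
  induction h with
  | refl =>
    refine ⟨.nil, fun f hf => ?_⟩
    obtain ⟨i, rfl⟩ | ⟨a, rfl⟩ := hA f hf
    · exact ⟨.input i, fun _ => rfl⟩
    · exact ⟨.const a, fun _ => rfl⟩
  | add _ hu hv ih =>
    obtain ⟨P, hP⟩ := ih
    obtain ⟨u', hu'⟩ := hP _ hu
    obtain ⟨v', hv'⟩ := hP _ hv
    refine ⟨P.snoc (.add u' v'), fun f hf => ?_⟩
    obtain rfl | hf := hf
    · exact ⟨_, fun x => (Operand.eval_last x P _).trans (by simp [Gate.eval, hu', hv'])⟩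
    · obtain ⟨w, hw⟩ := hP f hf
      exact ⟨w.lift, fun x => (Operand.eval_lift x P _ w).trans (hw x)⟩
  | sub _ hu hv ih =>
    obtain ⟨P, hP⟩ := ih
    obtain ⟨u', hu'⟩ := hP _ hu
    obtain ⟨v', hv'⟩ := hP _ hv
    refine ⟨P.snoc (.sub u' v'), fun f hf => ?_⟩
    obtain rfl | hf := hf
    · exact ⟨_, fun x => (Operand.eval_last x P _).trans (by simp [Gate.eval, hu', hv'])⟩
    · obtain ⟨w, hw⟩ := hP f hf
      exact ⟨w.lift, fun x => (Operand.eval_lift x P _ w).trans (hw x)⟩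
  | mul _ hu hv ih =>
    obtain ⟨P, hP⟩ := ih
    obtain ⟨u', hu'⟩ := hP _ hu
    obtain ⟨v', hv'⟩ := hP _ hv
    refine ⟨P.snoc (.mul u' v'), fun f hf => ?_⟩
    obtain rfl | hf := hf
    · exact ⟨_, fun x => (Operand.eval_last x P _).trans (by simp [Gate.eval, hu', hv'])⟩
    · obtain ⟨w, hw⟩ := hP f hf
      exact ⟨w.lift, fun x => (Operand.eval_lift x P _ w).trans (hw x)⟩

theorem Cost.exists_circuit {f : (X → ℂ) → Y → ℂ} {s : ℝ} (h : Cost f s) :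
    ∃ C : Circuit ℂ X Y, C.Computes f ∧ (C.size : ℝ) ≤ s := by
  obtain ⟨m, B, hm, hB, hT⟩ := h (X → ℂ)
    {g | (∃ i, g = fun x => x i) ∨ ∃ a, g = fun _ => a} (fun i x => x i)
    (fun a => .inr ⟨a, rfl⟩) (fun i => .inl ⟨i, rfl⟩)
  obtain ⟨P, hP⟩ := hB.exists_slp fun f hf => hf
  choose u hu using fun y => hP _ (hT ⟨y, rfl⟩)
  exact ⟨⟨m, P, u⟩, fun x => funext fun y => hu y x, hm⟩

theorem SLP.exists_derives {Ω : Type} {A : Set (Ω → ℂ)} {x : X → Ω → ℂ}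
    (hc : ∀ a : ℂ, (fun _ => a) ∈ A) (hx : ∀ i, x i ∈ A) {m : ℕ} (P : SLP ℂ X m) :
    ∃ B, Derives A m B ∧ ∀ u : Operand ℂ X m,
      (fun ω => u.eval (fun i => x i ω) (P.eval fun i => x i ω)) ∈ B := by
  induction P with
  | nil =>
    refine ⟨A, .refl, fun u => ?_⟩
    cases u with
    | input i => exact hx i
    | const a => exact hc a
    | result j => exact j.elim0
  | @snoc k P g ih =>
    obtain ⟨B, hB, hu⟩ := ih
    have key : ∃ B', Derives A (k + 1) B' ∧ B ⊆ B' ∧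
        (fun ω => g.eval (fun i => x i ω) (P.eval fun i => x i ω)) ∈ B' := by
      cases g with
      | add u v => exact ⟨_, hB.add (hu u) (hu v), Set.subset_insert _ _, .inl rfl⟩
      | sub u v => exact ⟨_, hB.sub (hu u) (hu v), Set.subset_insert _ _, .inl rfl⟩
      | mul u v => exact ⟨_, hB.mul (hu u) (hu v), Set.subset_insert _ _, .inl rfl⟩
    obtain ⟨B', hB', hsub, hg⟩ := key
    refine ⟨B', hB', fun u => ?_⟩
    cases u with
    | input i => exact hsub (hB.subset (hx i))
    | const a => exact hsub (hB.subset (hc a))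
    | result j =>
      induction j using Fin.lastCases with
      | last => simpa only [Operand.eval_last] using hg
      | cast j =>
        have := hsub (hu (.result j))
        simpa only [← Operand.eval_lift _ _ g, Operand.lift] using this

theorem Circuit.Computes.cost {C : Circuit ℂ X Y} {f : (X → ℂ) → Y → ℂ} (h : C.Computes f) :
    Cost f C.size := by
  intro Ω A x hc hx
  obtain ⟨B, hB, hu⟩ := C.prog.exists_derives hc hx
  refine ⟨C.size, B, le_rfl, hB, ?_⟩
  rintro _ ⟨y, rfl⟩
  have hy : (fun ω => f (fun i => x i ω) y) = fun ω => C.eval (fun i => x i ω) y :=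
    funext fun ω => (congrFun (h _) y).symm
  change (fun ω => f (fun i => x i ω) y) ∈ B
  rw [hy]
  exact hu (C.out y)

end Cost

/-! ### Matrix multiplication -/

section MatMul

variable {X : Type}

/-- `MatMulBound τ b`: two `n × n` matrices can be multiplied with `b * n ^ τ` operations, where
`b` and `τ` are large enough for the estimates below. -/
structure MatMulBound (τ b : ℝ) : Prop where
  two_le : 2 ≤ τ
  one_le : 1 ≤ b
  cost : ∀ n : ℕ, 1 ≤ n → Cost (matMul n) (b * (n : ℝ) ^ τ)

/-- Multiplication of rectangular matrices whose sides are at most `n`. -/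
theorem MatMulBound.cost_mul {τ b : ℝ} (hb : MatMulBound τ b) {n : ℕ} (hn : 1 ≤ n)
    {I J L : Type} [Fintype I] [Fintype J] [Fintype L] (hI : Fintype.card I ≤ n)
    (hJ : Fintype.card J ≤ n) (hL : Fintype.card L ≤ n)
    {f : (X → ℂ) → I × J → ℂ} {g : (X → ℂ) → J × L → ℂ} {s t : ℝ} (hf : Cost f s)
    (hg : Cost g t) :
    Cost (fun x (p : I × L) => ∑ j, f x (p.1, j) * g x (j, p.2)) (s + t + b * (n : ℝ) ^ τ) := by
  obtain ⟨eI⟩ := Function.Embedding.nonempty_of_card_le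
    (show Fintype.card I ≤ Fintype.card (Fin n) by simpa using hI)
  obtain ⟨eJ⟩ := Function.Embedding.nonempty_of_card_le
    (show Fintype.card J ≤ Fintype.card (Fin n) by simpa using hJ)
  obtain ⟨eL⟩ := Function.Embedding.nonempty_of_card_le
    (show Fintype.card L ≤ Fintype.card (Fin n) by simpa using hL)
  have iIJ := eI.injective.prodMap eJ.injective
  have iJL := eJ.injective.prodMap eL.injective
  -- both factors, extended by zero to square matrices
  let F : (X → ℂ) → (Fin n × Fin n) ⊕ (Fin n × Fin n) → ℂ := fun x => Sum.elim
    (Function.extend (Prod.map eI eJ) (f x) 0) (Function.extend (Prod.map eJ eL) (g x) 0)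
  have hF : Cost F (s + t) := by
    have h0 : Cost (fun (_ : X → ℂ) (_ : Unit) => (0 : ℂ)) 0 :=
      Cost.free fun y => .inr ⟨0, fun _ => rfl⟩
    have := Cost.of_family (ι := Option Bool)
      (Z := fun o => match o with | none => Unit | some true => I × J | some false => J × L)
      (f := fun o => match o with
        | none => fun _ _ => 0 | some true => f | some false => g)
      (s := fun o => match o with | none => 0 | some true => s | some false => t)
      (by rintro (_ | _ | _) <;> assumption) (g := F) ?_
    · simpa using this
    · rintro (p | p)
      · by_cases hp : ∃ q, Prod.map eI eJ q = p
        · obtain ⟨q, rfl⟩ := hp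
          exact ⟨some true, q, fun x => by simp only [F, Sum.elim_inl]; exact iIJ.extend_apply _ _ _⟩
        · exact ⟨none, (), fun x => by
            simp only [F, Sum.elim_inl]; rw [Function.extend_apply' _ _ _ hp]; rfl⟩
      · by_cases hp : ∃ q, Prod.map eJ eL q = p
        · obtain ⟨q, rfl⟩ := hp
          exact ⟨some false, q, fun x => by
            simp only [F, Sum.elim_inr]; exact iJL.extend_apply _ _ _⟩
        · exact ⟨none, (), fun x => by
            simp only [F, Sum.elim_inr]; rw [Function.extend_apply' _ _ _ hp]; rfl⟩
  refine ((hb.cost n hn).comp hF).reindex fun p => ⟨(eI p.1, eL p.2), fun x => ?_⟩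
  rw [matMul, Matrix.mul_apply]
  refine Fintype.sum_of_injective eJ eJ.injective _ _ (fun k hk => ?_) fun j => ?_
  · rw [Matrix.of_apply]
    simp only [F, Sum.elim_inl]
    rw [Function.extend_apply' _ _ _ (by rintro ⟨q, hq⟩; exact hk ⟨q.2, congrArg Prod.snd hq⟩)]
    simp
  · rw [Matrix.of_apply, Matrix.of_apply]
    simp only [F, Sum.elim_inl, Sum.elim_inr]
    rw [← iIJ.extend_apply (f x) 0 (p.1, j), ← iJL.extend_apply (g x) 0 (j, p.2)]
    rfl

/-- Multiplication by a constant matrix with many columns: the columns are split into `N` groups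
of size at most `n`. -/
theorem MatMulBound.cost_mul_const {τ b : ℝ} (hb : MatMulBound τ b) {n N : ℕ} (hn : 1 ≤ n)
    {I J L : Type} [Fintype I] [Fintype J] [Fintype L] (hI : Fintype.card I ≤ n)
    (hJ : Fintype.card J ≤ n) (hL : Fintype.card L ≤ N * n) (a : J × L → ℂ) :
    Cost (fun (x : I × J → ℂ) (p : I × L) => ∑ j, x (p.1, j) * a (j, p.2))
      (N * (b * (n : ℝ) ^ τ)) := by
  classical
  obtain ⟨e⟩ := Function.Embedding.nonempty_of_card_le
    (show Fintype.card L ≤ Fintype.card (Fin N × Fin n) by simpa using hL)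
  have hcard (c : Fin N) : Fintype.card {l // (e l).1 = c} ≤ n := by
    have : Function.Injective fun l : {l // (e l).1 = c} => (e l.1).2 := fun l l' h =>
      Subtype.ext (e.injective (Prod.ext (l.2.trans l'.2.symm) h))
    simpa using Fintype.card_le_of_injective _ this
  have key (c : Fin N) := hb.cost_mul (X := I × J) hn hI hJ (hcard c) (f := fun x => x)
    (g := fun _ p => a (p.1, p.2.1)) (Cost.free fun y => .inl ⟨y, fun _ => rfl⟩)
    (Cost.free fun y => .inr ⟨_, fun _ => rfl⟩)
  refine (Cost.of_family key (fun p : I × L => ⟨(e p.2).1, (p.1, ⟨p.2, rfl⟩), fun _ => rfl⟩)).mono ?_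
  simp

theorem isMatMulExponent_three : IsMatMulExponent 3 := by
  refine ⟨2, fun n _ => ?_⟩
  have h (j : Fin n) : Cost (fun (x : (Fin n × Fin n) ⊕ (Fin n × Fin n) → ℂ) (p : Fin n × Fin n) =>
      x (.inl (p.1, j)) * x (.inr (j, p.2))) (0 + 0 + Fintype.card (Fin n × Fin n)) :=
    Cost.mul (Cost.free fun p => .inl ⟨_, fun _ => rfl⟩) (Cost.free fun p => .inl ⟨_, fun _ => rfl⟩)
  refine Cost.exists_circuit ((Cost.sum h).mono ?_ |>.reindex fun p => ⟨p, fun x => ?_⟩)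
  · simp only [Fintype.card_prod, Fintype.card_fin, Finset.sum_const, Finset.card_univ,
      nsmul_eq_mul]
    push_cast
    rw [show (3 : ℝ) = (3 : ℕ) by norm_num, Real.rpow_natCast]
    apply le_of_eq; ring
  · simp [matMul, Matrix.mul_apply]

theorem Operand.exists_result {X : Type} {m : ℕ} {u : Operand ℂ X m}
    (h : (∀ i, u ≠ .input i) ∧ ∀ a, u ≠ .const a) : ∃ j, u = .result j := by
  cases u with
  | input i => exact absurd rfl (h.1 i)
  | const a => exact absurd rfl (h.2 a)
  | result j => exact ⟨j, rfl⟩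

/-- The `n ^ 2` entries of a product are different functions, and none of them is an input or a
constant, so that each needs an operation of its own. -/
theorem sq_le_size_of_computes_matMul {n : ℕ}
    {C : Circuit ℂ ((Fin n × Fin n) ⊕ (Fin n × Fin n)) (Fin n × Fin n)}
    (hC : C.Computes (matMul n)) : n ^ 2 ≤ C.size := by
  classical
  -- the pair of matrices `2 E_p` and `2`, whose product has entry `4` at `p` and `0` elsewhere
  let x (p : Fin n × Fin n) : (Fin n × Fin n) ⊕ (Fin n × Fin n) → ℂ :=
    Sum.elim (fun q => if q = p then 2 else 0) (fun q => if q.1 = q.2 then 2 else 0)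
  have hx (p q) : matMul n (x p) q = if q = p then 4 else 0 := by
    simp only [matMul, Matrix.mul_apply, Matrix.of_apply, x, Sum.elim_inl, Sum.elim_inr]
    rw [Finset.sum_eq_single q.2 (fun j _ hj => by simp [hj]) (by simp)]
    by_cases h : q = p <;> norm_num [h]
  have h0 (q) : matMul n 0 q = 0 := by simp [matMul, Matrix.mul_apply]
  have hout (p) : ∃ j, C.out p = .result j := by
    refine Operand.exists_result ⟨fun i hi => ?_, fun a ha => ?_⟩
    · have h4 : C.eval (x p) p = 4 := by rw [hC, hx, if_pos rfl]
      rw [Circuit.eval, hi, Operand.eval] at h4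
      rcases i with q | q <;> simp only [x, Sum.elim_inl, Sum.elim_inr] at h4 <;>
        split_ifs at h4 <;> norm_num at h4
    · have h4 : C.eval (x p) p = 4 := by rw [hC, hx, if_pos rfl]
      have h0 : C.eval 0 p = 0 := by rw [hC, h0]
      rw [Circuit.eval, ha, Operand.eval] at h4 h0
      norm_num [h4] at h0
  choose j hj using hout
  have hinj : Function.Injective j := by
    intro p q hpq
    by_contra hne
    have h4 : C.eval (x p) p = 4 := by rw [hC, hx, if_pos rfl]
    have h0 : C.eval (x p) q = 0 := by rw [hC, hx, if_neg (Ne.symm hne)]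
    rw [Circuit.eval, hj] at h4 h0
    rw [hpq, h0] at h4
    norm_num at h4
  simpa [sq] using Fintype.card_le_of_injective j hinj

theorem IsMatMulExponent.two_le {τ : ℝ} (h : IsMatMulExponent τ) : 2 ≤ τ := by
  obtain ⟨b, hb⟩ := h
  by_contra! hτ
  have hlim : Filter.Tendsto (fun n : ℕ => (n : ℝ) ^ (2 - τ)) Filter.atTop Filter.atTop :=
    (tendsto_rpow_atTop (by linarith)).comp tendsto_natCast_atTop_atTop
  obtain ⟨n, hn, hn1⟩ := ((hlim.eventually_gt_atTop b).and (Filter.eventually_ge_atTop 1)).exists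
  obtain ⟨C, hC, hsize⟩ := hb n hn1
  have h1 : ((n ^ 2 : ℕ) : ℝ) ≤ b * (n : ℝ) ^ τ :=
    (Nat.cast_le.2 (sq_le_size_of_computes_matMul hC)).trans hsize
  have hpos : (0 : ℝ) < n := by exact_mod_cast hn1
  have h2 : (n : ℝ) ^ (2 - τ) * (n : ℝ) ^ τ = (n : ℝ) ^ 2 := by
    rw [← Real.rpow_add hpos, sub_add_cancel]; norm_num
  have h3 := mul_lt_mul_of_pos_right hn (Real.rpow_pos_of_pos hpos τ)
  push_cast at h1
  linarith

theorem exists_matMulBound {ε : ℝ} (hε : 0 < ε) : ∃ τ b, MatMulBound τ b ∧ τ ≤ omega + ε := by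
  obtain ⟨τ, hτ, hlt⟩ := Real.lt_sInf_add_pos (s := {τ : ℝ | IsMatMulExponent τ})
    ⟨3, isMatMulExponent_three⟩ hε
  obtain ⟨b, hb⟩ := id hτ
  refine ⟨τ, max b 1, ⟨IsMatMulExponent.two_le hτ, le_max_right _ _, fun n hn => ?_⟩, hlt.le⟩
  obtain ⟨C, hC, hsize⟩ := hb n hn
  refine hC.cost.mono (hsize.trans ?_)
  gcongr
  exact le_max_left _ _

end MatMul

/-! ### Fourier transforms of cyclic groups -/

section Fourier

/-- The fast Fourier transform of length `2 ^ k`. -/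
theorem cost_fourier (k : ℕ) (w : ℂ) (hw : w ^ 2 ^ k = 1) :
    Cost (fun (x : Fin (2 ^ k) → ℂ) (l : Fin (2 ^ k)) => ∑ i : Fin (2 ^ k), w ^ ((l : ℕ) * i) * x i)
      (2 * 2 ^ k * k) := by
  induction k generalizing w with
  | zero =>
    refine (Cost.free fun l => .inl ⟨l, fun x => ?_⟩).mono (by simp)
    rw [Fintype.sum_eq_single l (fun i hi => absurd (Subsingleton.elim (α := Fin 1) i l) hi)]
    rw [show (l : ℕ) = 0 from Nat.lt_one_iff.1 l.2]
    simp
  | succ k ih =>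
    have hw2 : (w ^ 2) ^ 2 ^ k = 1 := by rw [← pow_mul, ← pow_succ', hw]
    let e : Fin (2 ^ k) × Fin 2 ≃ Fin (2 ^ (k + 1)) := finProdFinEquiv
    have he (p) : (e p : ℕ) = p.2 + 2 * p.1 := rfl
    have part (c : Fin 2) : Cost (fun (x : Fin (2 ^ (k + 1)) → ℂ) (l : Fin (2 ^ (k + 1))) =>
        ∑ i : Fin (2 ^ k), (w ^ 2) ^ ((l : ℕ) * i) * x (e (i, c))) (2 * 2 ^ k * k) := by
      have h0 : Cost (fun (x : Fin (2 ^ (k + 1)) → ℂ) i => x (e (i, c))) 0 :=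
        Cost.free fun i => .inl ⟨_, fun _ => rfl⟩
      refine (((ih _ hw2).comp h0).mono (by simp)).reindex fun l =>
        ⟨⟨l % 2 ^ k, Nat.mod_lt _ (by positivity)⟩, fun x => Finset.sum_congr rfl fun i _ => ?_⟩
      congr 1
      nth_rw 1 [← Nat.mod_add_div (l : ℕ) (2 ^ k)]
      rw [add_mul, pow_add, mul_assoc (2 ^ k), pow_mul _ (2 ^ k), hw2, one_pow, mul_one]
    refine ((part 0).add ((part 1).const_mul fun l => w ^ (l : ℕ))).mono ?_ |>.reindex
      fun l => ⟨l, fun x => ?_⟩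
    · simp only [Fintype.card_fin]
      push_cast
      apply le_of_eq; ring
    · rw [← e.sum_comp, Fintype.sum_prod_type]
      simp only [Fin.sum_univ_two, Finset.sum_add_distrib, Finset.mul_sum, he]
      congr 1 <;> refine Finset.sum_congr rfl fun i _ => ?_
      · simp only [← pow_mul]
        congr 2
        simp; ring
      · simp only [← pow_mul, ← mul_assoc, ← pow_add]
        congr 2
        simp; ring

theorem choose_two_add (a b : ℕ) : (a + b).choose 2 = a * b + a.choose 2 + b.choose 2 := by
  induction a with
  | zero => simp
  | succ a ih =>
    rw [add_right_comm, Nat.choose_succ_succ' (a + b) 1, Nat.choose_succ_succ' a 1, ih]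
    simp only [Nat.choose_one_right]
    ring

/-- Bluestein's method: since `l * i = (l + i).choose 2 - l.choose 2 - i.choose 2`, evaluation at
powers of `ζ` amounts to multiplication by a Hankel matrix, and a Hankel matrix is of the form
`Vᵀ * D * V` with `V` a Fourier matrix of length a power of two and `D` a diagonal matrix. -/
theorem cost_chirp {m : ℕ} (hm : 1 ≤ m) {ζ : ℂ} (hζ : ζ ≠ 0) :
    Cost (fun (x : Fin m → ℂ) (l : Fin m) => ∑ i : Fin m, ζ ^ ((l : ℕ) * i) * x i)
      (m * (38 + 16 * Real.logb 2 m)) := by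
  set k := Nat.log 2 m + 2 with hk
  have hN1 : 2 * m < 2 ^ k := by
    have := Nat.lt_pow_succ_log_self one_lt_two m
    rw [hk, pow_succ]; lia
  have hN2 : 2 ^ k ≤ 4 * m := by
    have := Nat.pow_log_le_self 2 (x := m) (by lia)
    rw [hk, pow_add]; lia
  obtain ⟨w, hw⟩ : ∃ w : ℂ, IsPrimitiveRoot w (2 ^ k) :=
    ⟨_, Complex.isPrimitiveRoot_exp (2 ^ k) (by positivity)⟩
  let V : Matrix (Fin (2 ^ k)) (Fin (2 ^ k)) ℂ := Matrix.vandermonde fun l => w ^ (l : ℕ)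
  have hV : IsUnit V.det := by
    rw [isUnit_iff_ne_zero]
    refine Matrix.det_vandermonde_ne_zero_iff.2 fun i j hij => Fin.ext ?_
    exact hw.pow_inj i.2 j.2 hij
  let h : Fin (2 ^ k) → ℂ := fun t => ζ ^ (t : ℕ).choose 2
  let a : Fin (2 ^ k) → ℂ := Matrix.vecMul h V⁻¹
  have ha (t : ℕ) (ht : t < 2 ^ k) : ∑ l, a l * w ^ ((l : ℕ) * t) = ζ ^ t.choose 2 := by
    have : Matrix.vecMul a V = h := by
      rw [Matrix.vecMul_vecMul, Matrix.nonsing_inv_mul _ hV, Matrix.vecMul_one]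
    have := congrFun this ⟨t, ht⟩
    simpa [Matrix.vecMul, dotProduct, V, Matrix.vandermonde, pow_mul] using this
  let v : ℕ → ℂ := fun i => (ζ ^ i.choose 2)⁻¹
  have c1 : Cost (fun (x : Fin m → ℂ) (i : Fin m) => v i * x i) m := by
    simpa using (Cost.free (f := fun (x : Fin m → ℂ) => x) fun i => .inl ⟨i, fun _ => rfl⟩).const_mul
      fun i => v i
  have c2 : Cost (fun (x : Fin m → ℂ) (i : Fin (2 ^ k)) => if h : (i : ℕ) < m then x ⟨i, h⟩ else 0)
      0 := Cost.free fun i => by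
    by_cases h : (i : ℕ) < m
    · exact .inl ⟨⟨i, h⟩, fun x => by simp [h]⟩
    · exact .inr ⟨0, fun x => by simp [h]⟩
  have c3 := cost_fourier k w hw.pow_eq_one
  have c4 := (c3.comp ((c3.comp (c2.comp c1)).const_mul a)).reindex (Z := Fin m)
    (g := fun x l => ∑ j : Fin (2 ^ k), w ^ ((l : ℕ) * j) * (a j * ∑ i : Fin (2 ^ k),
      w ^ ((j : ℕ) * i) * if h : (i : ℕ) < m then v i * x ⟨i, h⟩ else 0))
    fun l => ⟨⟨l, by lia⟩, fun x => rfl⟩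
  refine ((c4.const_mul fun l => v l).mono ?_).reindex fun l => ⟨l, fun x => ?_⟩
  · have hN2' : (2 : ℝ) ^ k ≤ 4 * m := by exact_mod_cast hN2
    have hlog : (k : ℝ) ≤ Real.logb 2 m + 2 := by
      have := Real.natLog_le_logb m 2
      rw [hk]; push_cast at this ⊢; linarith
    have h1 : (2 : ℝ) ^ k * k ≤ 4 * m * (Real.logb 2 m + 2) := by gcongr
    simp only [Fintype.card_fin]
    push_cast
    nlinarith
  · have hsum (j : Fin (2 ^ k)) : ∑ i : Fin (2 ^ k), (w ^ ((j : ℕ) * i) *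
        if h : (i : ℕ) < m then v i * x ⟨i, h⟩ else 0) =
        ∑ i : Fin m, w ^ ((j : ℕ) * i) * (v i * x i) := by
      refine (Fintype.sum_of_injective (Fin.castLE (by lia : m ≤ 2 ^ k))
        (Fin.castLE_injective _) _ _ (fun i hi => ?_) fun i => ?_).symm
      · rw [dif_neg, mul_zero]
        exact fun h => hi ⟨⟨i, h⟩, rfl⟩
      · simp
    simp only [hsum, Finset.mul_sum]
    rw [Finset.sum_comm]
    refine Finset.sum_congr rfl fun i _ => ?_
    have hli : (l : ℕ) + i < 2 ^ k := by lia
    have key := ha _ hli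
    rw [choose_two_add, pow_add ζ, pow_add ζ] at key
    have : ζ ^ ((l : ℕ) * i) = v l * v i * ∑ j, a j * w ^ ((j : ℕ) * (l + i)) := by
      rw [key]
      simp only [v]
      field_simp
    rw [this, Finset.mul_sum, Finset.sum_mul]
    refine Finset.sum_congr rfl fun j _ => ?_
    rw [mul_add, pow_add, mul_comm (j : ℕ) l]
    ring

end Fourier

section Cyclic

/-- `DFTCost G s`: every generalized DFT of `G` can be computed with `s` operations. -/
def DFTCost (G : Type) [Group G] [Fintype G] (s : ℝ) : Prop :=
  ∀ (ι : Type) (d : ι → ℕ) (ρ : ∀ i, G →* Matrix (Fin (d i)) (Fin (d i)) ℂ),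
    IsCompleteIrreps ρ → Cost (dft ρ) s

theorem dftCost_of_isCyclic (G : Type) [Group G] [Fintype G] [hG : IsCyclic G] :
    DFTCost G (Fintype.card G * (38 + 16 * Real.logb 2 (Fintype.card G))) := by
  intro ι d ρ hρ
  obtain ⟨g, hg⟩ := hG.exists_generator
  have hord : orderOf g = Fintype.card G := by
    rw [orderOf_eq_card_of_forall_mem_zpowers hg, Nat.card_eq_fintype_card]
  set m := Fintype.card G with hm
  have hm1 : 1 ≤ m := Fintype.card_pos
  obtain ⟨ζ, hζ⟩ : ∃ ζ : ℂ, IsPrimitiveRoot ζ m := ⟨_, Complex.isPrimitiveRoot_exp m (by lia)⟩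
  have hbij : Function.Bijective fun j : Fin m => g ^ (j : ℕ) := by
    rw [Fintype.bijective_iff_injective_and_card]
    refine ⟨fun i j hij => Fin.ext ?_, by simp [hm]⟩
    exact pow_injOn_Iio_orderOf (by simp [hord]) (by simp [hord]) hij
  have c0 : Cost (fun (c : G → ℂ) (j : Fin m) => c (g ^ (j : ℕ))) 0 :=
    Cost.free fun j => .inl ⟨_, fun _ => rfl⟩
  refine (((cost_chirp hm1 (hζ.ne_zero (by lia))).comp c0).mono (by simp)).reindex ?_
  rintro ⟨i, a, b⟩
  have : (toRep (ρ i)).IsIrreducible := hρ.irreducible i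
  have : IsMulCommutative G := IsCyclic.isMulCommutative
  have hd : d i = 1 := by
    simpa using Representation.IsIrreducible.finrank_eq_one_of_isMulCommutative (toRep (ρ i))
  have : Subsingleton (Fin (d i)) := by rw [hd]; infer_instance
  have hpow (j : ℕ) : ρ i (g ^ j) a b = (ρ i g a b) ^ j := by
    induction j with
    | zero => simp [Subsingleton.elim a b]
    | succ j ih =>
      rw [pow_succ, map_mul, Matrix.mul_apply, Fintype.sum_subsingleton _ a, pow_succ,
        ← ih, Subsingleton.elim a b]
  have hz : (ρ i g a b) ^ m = 1 := by
    rw [← hpow, ← hord, pow_orderOf_eq_one, map_one, Subsingleton.elim a b, Matrix.one_apply_eq]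
  obtain ⟨l, hl, hlz⟩ := hζ.eq_pow_of_pow_eq_one hz
  refine ⟨⟨l, hl⟩, fun c => ?_⟩
  rw [dft, Matrix.sum_apply, ← hbij.sum_comp]
  refine Finset.sum_congr rfl fun j _ => ?_
  rw [Matrix.smul_apply, hpow, ← hlz, ← pow_mul, smul_eq_mul, mul_comm]

end Cyclic

/-! ### Representations: Schur orthogonality and complete reducibility -/

section Irreducible

variable {G H : Type} [Group G] [Group H]

theorem isIrreducible_iff {V : Type*} [AddCommGroup V] [Module ℂ V]
    (ρ : Representation ℂ G V) : ρ.IsIrreducible ↔ Nontrivial V ∧ ∀ W : Submodule ℂ V,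
      (∀ g, ∀ v ∈ W, ρ g v ∈ W) → W = ⊥ ∨ W = ⊤ := by
  constructor
  · intro h
    refine ⟨?_, fun W hW => ?_⟩
    · by_contra hV
      rw [not_nontrivial_iff_subsingleton] at hV
      exact bot_ne_top (α := Subrepresentation ρ)
        (Subrepresentation.toSubmodule_injective (Subsingleton.elim _ _))
    · exact (eq_bot_or_eq_top (⟨W, fun g v hv => hW g v hv⟩ : Subrepresentation ρ)).imp
        (congrArg Subrepresentation.toSubmodule) (congrArg Subrepresentation.toSubmodule)
  · rintro ⟨hV, h⟩
    have : Nontrivial (Subrepresentation ρ) :=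
      ⟨⊥, ⊤, fun e => bot_ne_top (α := Submodule ℂ V) (congrArg Subrepresentation.toSubmodule e)⟩
    refine ⟨fun W => (h W.toSubmodule fun g v hv => W.apply_mem_toSubmodule g hv).imp
      (fun e => Subrepresentation.toSubmodule_injective e)
      (fun e => Subrepresentation.toSubmodule_injective e)⟩

/-- Irreducibility carries over to equivalent representations, and along changes of the group that
do not change the set of operators. -/
theorem isIrreducible_of_equiv {V W : Type*} [AddCommGroup V] [Module ℂ V] [AddCommGroup W]
    [Module ℂ W] {ρ : Representation ℂ G V} {σ : Representation ℂ H W} (f : V ≃ₗ[ℂ] W)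
    (φ : H → G) (hφ : Function.Surjective φ) (hf : ∀ h v, σ h (f v) = f (ρ (φ h) v))
    (hρ : ρ.IsIrreducible) : σ.IsIrreducible := by
  rw [isIrreducible_iff] at hρ ⊢
  obtain ⟨hV, hρ⟩ := hρ
  refine ⟨f.symm.toEquiv.nontrivial, fun U hU => ?_⟩
  have key := hρ (U.comap (f : V →ₗ[ℂ] W)) fun g v hv => by
    obtain ⟨h, rfl⟩ := hφ g
    simpa [hf] using hU h (f v) hv
  refine key.imp (fun e => ?_) (fun e => ?_)
  · rw [eq_bot_iff]
    intro w hw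
    have : f.symm w ∈ U.comap (f : V →ₗ[ℂ] W) := by simpa using hw
    rw [e] at this
    simpa using this
  · rw [eq_top_iff]
    intro w _
    have : f.symm w ∈ U.comap (f : V →ₗ[ℂ] W) := by rw [e]; trivial
    simpa using this

theorem toRep_apply {d : ℕ} (ρ : G →* Matrix (Fin d) (Fin d) ℂ) (g : G) (v : Fin d → ℂ) :
    toRep ρ g v = (ρ g).mulVec v := rfl

theorem schur_zero {d e : ℕ} {ρ : G →* Matrix (Fin d) (Fin d) ℂ}
    {σ : G →* Matrix (Fin e) (Fin e) ℂ} (hρ : (toRep ρ).IsIrreducible)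
    (hσ : (toRep σ).IsIrreducible) (hne : ¬ Nonempty ((toRep σ).Equiv (toRep ρ)))
    {A : Matrix (Fin d) (Fin e) ℂ} (hA : ∀ g, ρ g * A = A * σ g) : A = 0 := by
  have : IsEmpty ((toRep σ).Equiv (toRep ρ)) := not_nonempty_iff.1 hne
  let f : Representation.IntertwiningMap (toRep σ) (toRep ρ) := ⟨Matrix.toLin' A, fun g => by
    refine LinearMap.ext fun v => ?_
    simp only [LinearMap.comp_apply, Matrix.toLin'_apply, toRep_apply, Matrix.mulVec_mulVec, hA]⟩
  have hf : f = 0 := Subsingleton.elim _ _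
  have : Matrix.toLin' A = 0 := congrArg Representation.IntertwiningMap.toLinearMap hf
  exact Matrix.toLin'.map_eq_zero_iff.1 this

theorem schur_scalar {d : ℕ} {ρ : G →* Matrix (Fin d) (Fin d) ℂ} (hρ : (toRep ρ).IsIrreducible)
    {A : Matrix (Fin d) (Fin d) ℂ} (hA : ∀ g, ρ g * A = A * ρ g) : ∃ c : ℂ, A = c • 1 := by
  let f : Representation.IntertwiningMap (toRep ρ) (toRep ρ) := ⟨Matrix.toLin' A, fun g => by
    refine LinearMap.ext fun v => ?_
    simp only [LinearMap.comp_apply, Matrix.toLin'_apply, toRep_apply, Matrix.mulVec_mulVec, hA]⟩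
  obtain ⟨c, hc⟩ := (Representation.IsIrreducible.algebraMap_intertwiningMap_bijective_of_isAlgClosed
    (ρ := toRep ρ)).2 f
  refine ⟨c, ?_⟩
  have : Matrix.toLin' A = Matrix.toLin' (c • (1 : Matrix (Fin d) (Fin d) ℂ)) := by
    rw [map_smul, Matrix.toLin'_one]
    exact (congrArg Representation.IntertwiningMap.toLinearMap hc).symm
  exact Matrix.toLin'.injective this

theorem IsCompleteIrreps.neZero {ι : Type} {d : ι → ℕ}
    {ρ : ∀ i, G →* Matrix (Fin (d i)) (Fin (d i)) ℂ} (hρ : IsCompleteIrreps ρ) (i : ι) :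
    NeZero (d i) := by
  refine ⟨fun h => ?_⟩
  obtain ⟨hn, -⟩ := (isIrreducible_iff _).1 (hρ.irreducible i)
  have : IsEmpty (Fin (d i)) := by rw [h]; infer_instance
  exact not_subsingleton (Fin (d i) → ℂ) inferInstance

theorem mul_single_mul_apply {α β γ δ : Type} [Fintype β] [Fintype γ] [DecidableEq β]
    [DecidableEq γ] (M : Matrix α β ℂ) (N : Matrix γ δ ℂ) (a : α) (b : β) (e : γ) (c : δ) :
    (M * Matrix.single b e (1 : ℂ) * N) a c = M a b * N e c := by
  rw [Matrix.mul_apply, Finset.sum_eq_single e]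
  · simp
  · intro x _ hx
    rw [Matrix.mul_single_apply_of_ne _ _ _ _ _ hx, zero_mul]
  · simp

/-- The matrix coefficients of pairwise inequivalent irreducible representations are linearly
independent, even if rows and columns are written in different bases. -/
theorem IsCompleteIrreps.linearIndependent [Fintype G] {ι : Type} {d : ι → ℕ}
    {ρ : ∀ i, G →* Matrix (Fin (d i)) (Fin (d i)) ℂ} (hρ : IsCompleteIrreps ρ)
    {I J : ι → Type} [∀ i, Fintype (I i)] [∀ i, Fintype (J i)] [∀ i, DecidableEq (I i)]
    [∀ i, DecidableEq (J i)]
    {P : ∀ i, Matrix (I i) (Fin (d i)) ℂ} {P' : ∀ i, Matrix (Fin (d i)) (I i) ℂ}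
    {Q : ∀ i, Matrix (Fin (d i)) (J i) ℂ} {Q' : ∀ i, Matrix (J i) (Fin (d i)) ℂ}
    (hP : ∀ i, P i * P' i = 1)  (hQ : ∀ i, Q' i * Q i = 1) :
    LinearIndependent ℂ fun (p : Σ i, I i × J i) (g : G) =>
      (P p.1 * ρ p.1 g * Q p.1) p.2.1 p.2.2 := by
  classical
  -- averaging a matrix `E` over the group gives an intertwiner
  have avg (i j) (E : Matrix (Fin (d i)) (Fin (d j)) ℂ) (h : G) :
      ρ i h * ∑ g, ρ i g * E * ρ j g⁻¹ = (∑ g, ρ i g * E * ρ j g⁻¹) * ρ j h := by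
    rw [Matrix.mul_sum, Matrix.sum_mul]
    refine Fintype.sum_equiv (Equiv.mulLeft h) _ _ fun g => ?_
    simp only [Equiv.coe_mulLeft, mul_inv_rev, map_mul, Matrix.mul_assoc]
    rw [← map_mul, inv_mul_cancel, map_one, Matrix.mul_one]
  have term (i j) (a : I i) (b : J i) (c : I j) (e : J j) (g : G) :
      (P i * ρ i g * Q i) a b * (Q' j * ρ j g⁻¹ * P' j) e c =
        (P i * (ρ i g * (Q i * Matrix.single b e (1 : ℂ) * Q' j) * ρ j g⁻¹) * P' j) a c := by
    have : P i * (ρ i g * (Q i * Matrix.single b e (1 : ℂ) * Q' j) * ρ j g⁻¹) * P' j =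
        (P i * ρ i g * Q i) * Matrix.single b e (1 : ℂ) * (Q' j * ρ j g⁻¹ * P' j) := by
      simp only [Matrix.mul_assoc]
    rw [this, mul_single_mul_apply]
  have orth (i j) (a : I i) (b : J i) (c : I j) (e : J j) :
      ∑ g, (P i * ρ i g * Q i) a b * (Q' j * ρ j g⁻¹ * P' j) e c =
        (P i * (∑ g, ρ i g * (Q i * Matrix.single b e (1 : ℂ) * Q' j) * ρ j g⁻¹) * P' j) a c := by
    simp only [term, Matrix.mul_sum, Matrix.sum_mul, Matrix.sum_apply]
  have hG : (Fintype.card G : ℂ) ≠ 0 := by exact_mod_cast Fintype.card_ne_zero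
  have diag (i) (a : I i) (b : J i) (c : I i) (e : J i) :
      ∑ g, (P i * ρ i g * Q i) a b * (Q' i * ρ i g⁻¹ * P' i) e c =
        if a = c ∧ b = e then (Fintype.card G : ℂ) / d i else 0 := by
    have := hρ.neZero i
    have hd : (d i : ℂ) ≠ 0 := by exact_mod_cast NeZero.ne (d i)
    obtain ⟨s, hs⟩ := schur_scalar (hρ.irreducible i)
      (avg i i (Q i * Matrix.single b e (1 : ℂ) * Q' i))
    have htr := congrArg Matrix.trace hs
    simp only [Matrix.trace_sum] at htr
    have (g : G) : (ρ i g * (Q i * Matrix.single b e (1 : ℂ) * Q' i) * ρ i g⁻¹).trace =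
        if b = e then 1 else 0 := by
      rw [Matrix.trace_mul_comm, ← Matrix.mul_assoc, ← map_mul, inv_mul_cancel, map_one,
        Matrix.one_mul, Matrix.trace_mul_comm, ← Matrix.mul_assoc, hQ, Matrix.one_mul]
      split_ifs with h
      · rw [h, Matrix.trace_single_eq_same]
      · rw [Matrix.trace_single_eq_of_ne _ _ _ h]
    simp only [this, Finset.sum_const, Finset.card_univ, nsmul_eq_mul, Matrix.trace_smul,
      Matrix.trace_one, Fintype.card_fin, smul_eq_mul] at htr
    rw [orth, hs]
    simp only [Matrix.mul_smul, Matrix.mul_one, Matrix.smul_mul, hP, Matrix.smul_apply,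
      Matrix.one_apply, smul_eq_mul]
    by_cases hac : a = c <;> by_cases hbe : b = e <;> simp [hac, hbe] at htr ⊢
    · rw [htr]; field_simp
    · exact htr.resolve_right (NeZero.ne _)
  have off (i j) (hij : i ≠ j) (a : I i) (b : J i) (c : I j) (e : J j) :
      ∑ g, (P i * ρ i g * Q i) a b * (Q' j * ρ j g⁻¹ * P' j) e c = 0 := by
    rw [orth, schur_zero (hρ.irreducible i) (hρ.irreducible j)
      (fun h => hij (hρ.inequivalent j i h).symm) (avg i j _)]
    simp
  rw [linearIndependent_iff']
  rintro s w hw ⟨i, a, b⟩ hp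
  have := hρ.neZero i
  have hd : (d i : ℂ) ≠ 0 := by exact_mod_cast NeZero.ne (d i)
  have h0 : ∑ g, (∑ q ∈ s, w q * (P q.1 * ρ q.1 g * Q q.1) q.2.1 q.2.2) *
      (Q' i * ρ i g⁻¹ * P' i) b a = 0 := by
    refine Finset.sum_eq_zero fun g _ => ?_
    have := congrFun hw g
    simp only [Finset.sum_apply, Pi.smul_apply, smul_eq_mul, Pi.zero_apply] at this
    rw [this, zero_mul]
  simp only [Finset.sum_mul, mul_assoc] at h0
  rw [Finset.sum_comm] at h0
  simp only [← Finset.mul_sum] at h0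
  rw [Finset.sum_eq_single ⟨i, a, b⟩] at h0
  · dsimp only at h0
    rw [diag, if_pos ⟨rfl, rfl⟩] at h0
    exact (mul_eq_zero.1 h0).resolve_right (div_ne_zero hG hd)
  · rintro ⟨j, c, e⟩ _ hne
    by_cases hij : j = i
    · subst hij
      have := diag j c e a b
      dsimp only
      rw [this, if_neg, mul_zero]
      rintro ⟨rfl, rfl⟩
      exact hne rfl
    · have := off j i hij c e a b
      dsimp only
      rw [this, mul_zero]
  · exact fun h => absurd hp h

end Irreducible

section Decomposition

variable {G H : Type} [Group G] [Group H]

theorem IsCompleteIrreps.linearIndependent_coeff [Fintype G] {ι : Type} {d : ι → ℕ}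
    {ρ : ∀ i, G →* Matrix (Fin (d i)) (Fin (d i)) ℂ} (hρ : IsCompleteIrreps ρ) :
    LinearIndependent ℂ fun (p : Σ i, Fin (d i) × Fin (d i)) (g : G) =>
      ρ p.1 g p.2.1 p.2.2 := by
  have := hρ.linearIndependent (I := fun i => Fin (d i)) (J := fun i => Fin (d i))
    (P := fun _ => 1) (P' := fun _ => 1) (Q := fun _ => 1) (Q' := fun _ => 1)
    (fun _ => Matrix.one_mul _) (fun _ => Matrix.one_mul _)
  simp only [Matrix.one_mul, Matrix.mul_one] at this
  exact this

theorem IsCompleteIrreps.finite [Fintype G] {ι : Type} {d : ι → ℕ}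
    {ρ : ∀ i, G →* Matrix (Fin (d i)) (Fin (d i)) ℂ} (hρ : IsCompleteIrreps ρ) : Finite ι := by
  have := hρ.neZero
  have := hρ.linearIndependent_coeff.finite
  exact Finite.of_injective (fun i => (⟨i, 0, 0⟩ : Σ i, Fin (d i) × Fin (d i)))
    fun i j h => congrArg Sigma.fst h

theorem IsCompleteIrreps.sum_sq_le [Fintype G] {ι : Type} [Fintype ι] {d : ι → ℕ}
    {ρ : ∀ i, G →* Matrix (Fin (d i)) (Fin (d i)) ℂ} (hρ : IsCompleteIrreps ρ) :
    ∑ i, d i ^ 2 ≤ Fintype.card G := by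
  simpa [sq] using hρ.linearIndependent_coeff.fintype_card_le_finrank

/-- Choose a member of every equivalence class of irreducible matrix representations. -/
theorem exists_isCompleteIrreps (G : Type) [Group G] :
    ∃ (ι : Type) (d : ι → ℕ) (ρ : ∀ i, G →* Matrix (Fin (d i)) (Fin (d i)) ℂ),
      IsCompleteIrreps ρ := by
  let R := {p : Σ m, G →* Matrix (Fin m) (Fin m) ℂ // (toRep p.2).IsIrreducible}
  let s : Setoid R := ⟨fun p q => Nonempty ((toRep p.1.2).Equiv (toRep q.1.2)),
    ⟨fun _ => ⟨.refl _⟩, fun ⟨e⟩ => ⟨e.symm⟩, fun ⟨e⟩ ⟨f⟩ => ⟨e.trans f⟩⟩⟩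
  refine ⟨Quotient s, fun i => i.out.1.1, fun i => i.out.1.2, fun i => i.out.2, fun i j h => ?_,
    fun m σ hσ => ?_⟩
  · rw [← i.out_eq, ← j.out_eq]
    exact Quotient.sound h
  · exact ⟨Quotient.mk s ⟨⟨m, σ⟩, hσ⟩, (Quotient.mk_out (s := s) ⟨⟨m, σ⟩, hσ⟩).map fun e => e.symm⟩

/-- A basis adapted to a decomposition into irreducible representations: the basis vectors are
grouped into blocks, and the block `j` is transformed by the member `t j` of the family `σ`. -/
structure AdaptedBasis {κ : Type} {e : κ → ℕ} (σ : ∀ i, H →* Matrix (Fin (e i)) (Fin (e i)) ℂ)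
    {V : Type} [AddCommGroup V] [Module ℂ V] (π : Representation ℂ H V) where
  /-- The blocks. -/
  J : Type
  fintype : Fintype J
  /-- The member of the family that belongs to a block. -/
  t : J → κ
  basis : Module.Basis (Σ j, Fin (e (t j))) ℂ V
  apply_basis : ∀ h j c, π h (basis ⟨j, c⟩) = ∑ a, σ (t j) h a c • basis ⟨j, a⟩

theorem IsCompleteIrreps.nonempty_adaptedBasis_of_isIrreducible {κ : Type} {e : κ → ℕ}
    {σ : ∀ i, H →* Matrix (Fin (e i)) (Fin (e i)) ℂ} (hσ : IsCompleteIrreps σ) {V : Type}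
    [AddCommGroup V] [Module ℂ V] [FiniteDimensional ℂ V] {π : Representation ℂ H V}
    (hπ : π.IsIrreducible) : Nonempty (AdaptedBasis σ π) := by
  let f : V ≃ₗ[ℂ] (Fin (Module.finrank ℂ V) → ℂ) := (Module.finBasis ℂ V).equivFun
  let τ : H →* Matrix (Fin (Module.finrank ℂ V)) (Fin (Module.finrank ℂ V)) ℂ :=
    ((LinearMap.toMatrixAlgEquiv (Module.finBasis ℂ V)) : _ →* _).comp π
  have hτ (h v) : toRep τ h (f v) = f (π h v) := by
    rw [toRep_apply]
    exact LinearMap.toMatrix_mulVec_repr _ _ (π h) v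
  obtain ⟨i, ⟨φ⟩⟩ := hσ.complete _ τ
    (isIrreducible_of_equiv f id Function.surjective_id (by simpa using hτ) hπ)
  let ψ : V ≃ₗ[ℂ] (Fin (e i) → ℂ) := f.trans φ.toLinearEquiv
  have hψ (h v) : ψ (π h v) = (σ i h).mulVec (ψ v) := by
    have := Representation.IntertwiningMap.isIntertwining _ _ φ.toIntertwiningMap h (f v)
    rw [hτ] at this
    exact this
  refine ⟨⟨Unit, inferInstance, fun _ => i, ((Pi.basisFun ℂ (Fin (e i))).map ψ.symm).reindex
    (Equiv.uniqueSigma fun _ : Unit => Fin (e i)).symm, ?_⟩⟩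
  rintro h ⟨⟩ c
  apply ψ.injective
  rw [hψ]
  simp only [map_sum, map_smul, Module.Basis.reindex_apply, Equiv.symm_symm, Module.Basis.map_apply,
    LinearEquiv.apply_symm_apply, Pi.basisFun_apply]
  change (σ i h).mulVec (Pi.single c 1) = ∑ x, σ i h x c • Pi.single x 1
  ext x
  simp [Pi.single_apply]

/-- Complete reducibility: split off a complement of an invariant subspace as long as possible. -/
theorem IsCompleteIrreps.nonempty_adaptedBasis [Finite H] {κ : Type} {e : κ → ℕ}
    {σ : ∀ i, H →* Matrix (Fin (e i)) (Fin (e i)) ℂ} (hσ : IsCompleteIrreps σ) {V : Type}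
    [AddCommGroup V] [Module ℂ V] [FiniteDimensional ℂ V] (π : Representation ℂ H V) :
    Nonempty (AdaptedBasis σ π) := by
  induction hn : Module.finrank ℂ V using Nat.strong_induction_on generalizing V with
  | _ n ih =>
  by_cases hV : Subsingleton V
  · exact ⟨⟨Empty, inferInstance, Empty.elim, Module.Basis.empty V, fun _ j => j.elim⟩⟩
  by_cases hπ : π.IsIrreducible
  · exact hσ.nonempty_adaptedBasis_of_isIrreducible hπ
  obtain ⟨W, hW, hW0, hW1⟩ : ∃ W : Submodule ℂ V, (∀ g, ∀ v ∈ W, π g v ∈ W) ∧ W ≠ ⊥ ∧ W ≠ ⊤ := by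
    rw [isIrreducible_iff] at hπ
    push Not at hπ
    exact hπ (not_subsingleton_iff_nontrivial.1 hV)
  let W₁ : Subrepresentation π := ⟨W, fun g v hv => hW g v hv⟩
  have : NeZero (Nat.card H : ℂ) := ⟨by exact_mod_cast Nat.card_pos.ne'⟩
  obtain ⟨W₂, hc⟩ := exists_isCompl W₁
  have hcompl : IsCompl W₁.toSubmodule W₂.toSubmodule :=
    ⟨disjoint_iff.2 (congrArg Subrepresentation.toSubmodule hc.inf_eq_bot),
      codisjoint_iff.2 (congrArg Subrepresentation.toSubmodule hc.sup_eq_top)⟩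
  have hadd := Submodule.finrank_add_eq_of_isCompl hcompl
  have h1 : 0 < Module.finrank ℂ W₁.toSubmodule := by
    rw [Module.finrank_pos_iff]
    exact Submodule.nontrivial_iff_ne_bot.2 hW0
  have h2 : Module.finrank ℂ W₁.toSubmodule < n := hn ▸ Submodule.finrank_lt hW1
  obtain ⟨B₁⟩ := ih _ h2 W₁.toRepresentation rfl
  obtain ⟨B₂⟩ := ih _ (by lia) W₂.toRepresentation rfl
  have := B₁.fintype
  have := B₂.fintype
  let b := (B₁.basis.prod B₂.basis).map (Submodule.prodEquivOfIsCompl _ _ hcompl)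
  have hb₁ (p) : b (.inl p) = (B₁.basis p : V) := by simp [b]
  have hb₂ (p) : b (.inr p) = (B₂.basis p : V) := by simp [b]
  let s : (Σ j : B₁.J ⊕ B₂.J, Fin (e (Sum.elim B₁.t B₂.t j))) ≃
      (Σ j, Fin (e (B₁.t j))) ⊕ (Σ j, Fin (e (B₂.t j))) :=
    Equiv.sumSigmaDistrib fun j => Fin (e (Sum.elim B₁.t B₂.t j))
  have hs₁ (j c) : b.reindex s.symm ⟨.inl j, c⟩ = (B₁.basis ⟨j, c⟩ : V) := by
    rw [Module.Basis.reindex_apply]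
    exact hb₁ ⟨j, c⟩
  have hs₂ (j c) : b.reindex s.symm ⟨.inr j, c⟩ = (B₂.basis ⟨j, c⟩ : V) := by
    rw [Module.Basis.reindex_apply]
    exact hb₂ ⟨j, c⟩
  refine ⟨⟨B₁.J ⊕ B₂.J, inferInstance, Sum.elim B₁.t B₂.t, b.reindex s.symm, ?_⟩⟩
  rintro h (j | j) c
  · have := congrArg Subtype.val (B₁.apply_basis h j c)
    rw [AddSubmonoidClass.coe_finsetSum] at this
    simp only [hs₁]
    exact this
  · have := congrArg Subtype.val (B₂.apply_basis h j c)
    rw [AddSubmonoidClass.coe_finsetSum] at this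
    simp only [hs₂]
    exact this

end Decomposition

section Splitting

variable {G H K : Type} [Group G] [Group H] [Group K]

/-- A change of basis that makes the matrix representation `π` block diagonal, with blocks from
the family `σ`. Rows and columns in the new basis are indexed by triples `⟨a, j, x⟩`, where `a` is a
member of the family, `j : J a` numbers the copies of `σ a` in `π`, and `x` is a coordinate of
`σ a`. -/
structure Splitting {κ : Type} [Fintype κ] {e : κ → ℕ}
    (σ : ∀ i, H →* Matrix (Fin (e i)) (Fin (e i)) ℂ) {d : ℕ}
    (π : H →* Matrix (Fin d) (Fin d) ℂ) where
  /-- The copies of each member of the family. -/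
  J : κ → Type
  fintype : ∀ a, Fintype (J a)
  decEq : DecidableEq (Σ a, J a × Fin (e a))
  /-- From the given basis to the new one. -/
  P : Matrix (Σ a, J a × Fin (e a)) (Fin d) ℂ
  /-- From the new basis to the given one. -/
  P' : Matrix (Fin d) (Σ a, J a × Fin (e a)) ℂ
  card_eq : Fintype.card (Σ a, J a × Fin (e a)) = d
  P_mul_P' : P * P' = 1
  P'_mul_P : P' * P = 1
  P_mul : ∀ h a j x y, (P * π h) ⟨a, j, x⟩ y = ∑ x', σ a h x x' * P ⟨a, j, x'⟩ y
  mul_P' : ∀ h a j x y, (π h * P') y ⟨a, j, x⟩ = ∑ x', P' y ⟨a, j, x'⟩ * σ a h x' x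

attribute [instance] Splitting.fintype Splitting.decEq

/-- Grouping the blocks of a block matrix according to their type. -/
def sigmaFiberEquiv {J κ : Type} (t : J → κ) (e : κ → ℕ) :
    (Σ a, {j // t j = a} × Fin (e a)) ≃ Σ j, Fin (e (t j)) where
  toFun p := ⟨p.2.1.1, p.2.1.2.symm ▸ p.2.2⟩
  invFun p := ⟨t p.1, ⟨p.1, rfl⟩, p.2⟩
  left_inv := by rintro ⟨_, ⟨j, rfl⟩, x⟩; rfl
  right_inv := by rintro ⟨j, x⟩; rfl

theorem IsCompleteIrreps.nonempty_splitting [Finite H] {κ : Type} [Fintype κ] {e : κ → ℕ}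
    {σ : ∀ i, H →* Matrix (Fin (e i)) (Fin (e i)) ℂ} (hσ : IsCompleteIrreps σ) {d : ℕ}
    (π : H →* Matrix (Fin d) (Fin d) ℂ) : Nonempty (Splitting σ π) := by
  classical
  obtain ⟨B⟩ := hσ.nonempty_adaptedBasis (toRep π)
  let _ : Fintype B.J := B.fintype
  let E := sigmaFiberEquiv B.t e
  let b := B.basis.reindex E.symm
  have hb (h a j x) : (π h).mulVec (b ⟨a, j, x⟩) = ∑ x', σ a h x' x • b ⟨a, j, x'⟩ := by
    obtain ⟨j, rfl⟩ := j
    simp only [b, Module.Basis.reindex_apply, Equiv.symm_symm]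
    exact B.apply_basis h j x
  let P := b.toMatrix (Pi.basisFun ℂ (Fin d))
  let P' := (Pi.basisFun ℂ (Fin d)).toMatrix b
  have h1 : P * P' = 1 := b.toMatrix_mul_toMatrix_flip _
  have h2 : P' * P = 1 := (Pi.basisFun ℂ (Fin d)).toMatrix_mul_toMatrix_flip b
  have hP' (y p) : P' y p = b p y := rfl
  have hmul (h a j x y) : (π h * P') y ⟨a, j, x⟩ = ∑ x', P' y ⟨a, j, x'⟩ * σ a h x' x := by
    have := congrFun (hb h a j x) y
    simp only [Matrix.mulVec, dotProduct, Finset.sum_apply, Pi.smul_apply, smul_eq_mul] at this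
    rw [Matrix.mul_apply]
    simp only [hP', this, mul_comm]
  refine ⟨⟨fun a => {j // B.t j = a}, inferInstance, inferInstance, P, P', ?_, h1, h2, ?_, hmul⟩⟩
  · rw [← Module.finrank_eq_card_basis b]; simp
  · intro h a j x y
    -- write `P * π h` as `(P * π h * P') * P` and use the formula for `π h * P'`
    have e1 : P * π h = (P * (π h * P')) * P := by
      rw [Matrix.mul_assoc, Matrix.mul_assoc, h2, Matrix.mul_one]
    have e2 (a' j' x'') : (P * (π h * P')) ⟨a, j, x⟩ ⟨a', j', x''⟩ =
        ∑ x', (1 : Matrix (Σ a, {j // B.t j = a} × Fin (e a)) (Σ a, {j // B.t j = a} × Fin (e a)) ℂ)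
          ⟨a, j, x⟩ ⟨a', j', x'⟩ *
          σ a' h x' x'' := by
      rw [Matrix.mul_apply]
      simp only [hmul, Finset.mul_sum, ← mul_assoc]
      rw [Finset.sum_comm]
      simp only [← Finset.sum_mul, ← Matrix.mul_apply, h1]
    rw [e1, Matrix.mul_apply, Fintype.sum_sigma, Finset.sum_eq_single a]
    · rw [Fintype.sum_prod_type, Finset.sum_eq_single j]
      · refine Finset.sum_congr rfl fun x'' _ => ?_
        rw [e2, Finset.sum_eq_single x]
        · simp
        · intro z _ hz
          simp [hz.symm]
        · simp
      · intro j' _ hj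
        refine Finset.sum_eq_zero fun x'' _ => ?_
        rw [e2, Finset.sum_eq_zero, zero_mul]
        intro z _
        simp [hj.symm]
      · simp
    · intro a' _ ha
      refine Finset.sum_eq_zero fun p _ => ?_
      rw [e2, Finset.sum_eq_zero, zero_mul]
      intro z _
      simp [ha.symm]
    · simp

variable {κ κ' : Type} [Fintype κ] [Fintype κ'] {e : κ → ℕ} {f : κ' → ℕ}
  {σ : ∀ i, H →* Matrix (Fin (e i)) (Fin (e i)) ℂ} {τ : ∀ i, K →* Matrix (Fin (f i)) (Fin (f i)) ℂ}

/-- With rows adapted to `H` and columns adapted to `K`, the blocks of `ρ` transform by `σ` on the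
left and by `τ` on the right. -/
theorem Splitting.equivariant {d : ℕ} {ρ : G →* Matrix (Fin d) (Fin d) ℂ} {φ : H →* G}
    {ψ : K →* G} (A : Splitting σ (ρ.comp φ)) (B : Splitting τ (ρ.comp ψ)) (h : H) (g : G) (k : K)
    (a j x b l y) : (A.P * ρ (φ h * g * ψ k) * B.P') ⟨a, j, x⟩ ⟨b, l, y⟩ =
      ∑ x', ∑ y', σ a h x x' * τ b k y' y * (A.P * ρ g * B.P') ⟨a, j, x'⟩ ⟨b, l, y'⟩ := by
  have left {γ : Type} (N : Matrix (Fin d) γ ℂ) (z : γ) :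
      (A.P * ρ.comp φ h * N) ⟨a, j, x⟩ z = ∑ x', σ a h x x' * (A.P * N) ⟨a, j, x'⟩ z := by
    simp only [Matrix.mul_apply (N := N), A.P_mul, Finset.sum_mul, Finset.mul_sum, mul_assoc]
    exact Finset.sum_comm
  have right {γ : Type} (N : Matrix γ (Fin d) ℂ) (z : γ) :
      (N * (ρ.comp ψ k * B.P')) z ⟨b, l, y⟩ = ∑ y', τ b k y' y * (N * B.P') z ⟨b, l, y'⟩ := by
    simp only [Matrix.mul_apply (M := N), B.mul_P', Finset.mul_sum]
    rw [Finset.sum_comm]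
    refine Finset.sum_congr rfl fun _ _ => Finset.sum_congr rfl fun _ _ => by ring
  have : A.P * ρ (φ h * g * ψ k) * B.P' =
      A.P * ρ.comp φ h * (ρ g * (ρ.comp ψ k * B.P')) := by
    simp only [map_mul, Matrix.mul_assoc, MonoidHom.comp_apply]
  rw [this, left]
  refine Finset.sum_congr rfl fun x' _ => ?_
  rw [← Matrix.mul_assoc, right, Finset.mul_sum]
  refine Finset.sum_congr rfl fun y' _ => by ring

/-- If `G` is covered by the sets `φ(H) s_w ψ(K)`, `w ∈ W`, then irreducible representations `σ` of
`H` and `τ` of `K`, of degrees `e` and `f`, occur together in the restrictions of irreducible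
representations of `G` at most `|W| e f` times, counted with multiplicities: the corresponding
matrix coefficients are linearly independent, and by equivariance they are determined by the values
at the `s_w` of `e × f` matrices. -/
theorem Splitting.card_le [Fintype G] {ι : Type} [Fintype ι] {d : ι → ℕ}
    {ρ : ∀ i, G →* Matrix (Fin (d i)) (Fin (d i)) ℂ} (hρ : IsCompleteIrreps ρ)
    (hσ : IsCompleteIrreps σ) (hτ : IsCompleteIrreps τ) {φ : H →* G} {ψ : K →* G}
    {W : Type} [Fintype W] {s : W → G} (hs : ∀ g, ∃ h w k, g = φ h * s w * ψ k)
    (A : ∀ i, Splitting σ ((ρ i).comp φ)) (B : ∀ i, Splitting τ ((ρ i).comp ψ)) (a : κ) (b : κ') :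
    Fintype.card (Σ i, (A i).J a × (B i).J b) ≤ Fintype.card W * (e a * f b) := by
  have := hσ.neZero a
  have := hτ.neZero b
  have hlin := hρ.linearIndependent (P := fun i => (A i).P) (P' := fun i => (A i).P')
    (Q := fun i => (B i).P') (Q' := fun i => (B i).P) (fun i => (A i).P_mul_P')
    (fun i => (B i).P_mul_P')
  have hlin' := hlin.comp (fun p : Σ i, (A i).J a × (B i).J b =>
    ⟨p.1, ⟨a, p.2.1, 0⟩, ⟨b, p.2.2, 0⟩⟩) (by
      rintro ⟨i, j, l⟩ ⟨i', j', l'⟩ h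
      simp only [Sigma.mk.injEq] at h
      obtain ⟨rfl, h⟩ := h
      simpa using h)
  have hlin'' : LinearIndependent ℂ fun (p : Σ i, (A i).J a × (B i).J b)
      (q : W × (Fin (e a) × Fin (f b))) =>
      ((A p.1).P * ρ p.1 (s q.1) * (B p.1).P') ⟨a, p.2.1, q.2.1⟩ ⟨b, p.2.2, q.2.2⟩ := by
    rw [Fintype.linearIndependent_iff] at hlin' ⊢
    intro c hc
    refine hlin' c (funext fun g => ?_)
    obtain ⟨h, w, k, rfl⟩ := hs g
    have hc' (x y) := congrFun hc (w, x, y)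
    simp only [Finset.sum_apply, Pi.smul_apply, smul_eq_mul, Pi.zero_apply, Function.comp_apply,
      (A _).equivariant (B _), Finset.mul_sum] at hc' ⊢
    rw [Finset.sum_comm]
    refine Finset.sum_eq_zero fun x' _ => ?_
    rw [Finset.sum_comm]
    refine Finset.sum_eq_zero fun y' _ => ?_
    rw [← mul_zero (σ a h 0 x' * τ b k y' 0), ← hc' x' y', Finset.mul_sum]
    exact Finset.sum_congr rfl fun _ _ => by ring
  simpa using hlin''.fintype_card_le_finrank

end Splitting

/-! ### The double subgroup reduction -/

section Reduction

theorem Cost.nonneg {X Y : Type} {f : (X → ℂ) → Y → ℂ} {s : ℝ} (h : Cost f s) : 0 ≤ s := by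
  obtain ⟨m, _, hm, -⟩ := h Unit Set.univ (fun _ _ => 0) (fun _ => trivial) fun _ => trivial
  exact m.cast_nonneg.trans hm

theorem DFTCost.nonneg {G : Type} [Group G] [Fintype G] {s : ℝ} (h : DFTCost G s) : 0 ≤ s := by
  obtain ⟨ι, d, ρ, hρ⟩ := exists_isCompleteIrreps G
  exact (h ι d ρ hρ).nonneg

theorem dft_apply {G : Type} [Group G] [Fintype G] {ι : Type} {d : ι → ℕ}
    (ρ : ∀ i, G →* Matrix (Fin (d i)) (Fin (d i)) ℂ) (c : G → ℂ) (i : ι) (x y : Fin (d i)) :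
    dft ρ c ⟨i, x, y⟩ = ∑ g, c g * ρ i g x y := by
  simp [dft, Matrix.sum_apply]

/-- Since `∑ d_i ^ 2 ≤ m`, we have `∑ d_i ^ τ ≤ m ^ (τ / 2)` for all `τ ≥ 2`. -/
theorem sum_rpow_le {ι : Type} [Fintype ι] {d : ι → ℕ} {m : ℕ} (hm : 1 ≤ m)
    (h : ∑ i, d i ^ 2 ≤ m) {τ : ℝ} (hτ : 2 ≤ τ) : ∑ i, (d i : ℝ) ^ τ ≤ (m : ℝ) ^ (τ / 2) := by
  have hm' : (0 : ℝ) < m := by exact_mod_cast hm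
  have h1 (i) : (d i : ℝ) ^ τ ≤ (d i : ℝ) ^ 2 * (m : ℝ) ^ (τ / 2 - 1) := by
    rcases Nat.eq_zero_or_pos (d i) with h0 | h0
    · rw [h0, Nat.cast_zero, Real.zero_rpow (by linarith)]
      positivity
    · have h0' : (0 : ℝ) < d i := by exact_mod_cast h0
      have h2 : (d i : ℝ) ^ τ = (d i : ℝ) ^ 2 * ((d i : ℝ) ^ 2) ^ (τ / 2 - 1) := by
        rw [← Real.rpow_natCast, ← Real.rpow_mul h0'.le, ← Real.rpow_add h0']
        congr 1; push_cast; ring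
      rw [h2]
      gcongr
      · linarith
      · exact_mod_cast (Finset.single_le_sum (f := fun i => d i ^ 2) (fun _ _ => Nat.zero_le _)
          (Finset.mem_univ i)).trans h
  calc ∑ i, (d i : ℝ) ^ τ ≤ ∑ i, (d i : ℝ) ^ 2 * (m : ℝ) ^ (τ / 2 - 1) :=
        Finset.sum_le_sum fun i _ => h1 i
    _ = (∑ i, (d i : ℝ) ^ 2) * (m : ℝ) ^ (τ / 2 - 1) := by rw [Finset.sum_mul]
    _ ≤ m * (m : ℝ) ^ (τ / 2 - 1) := by
        gcongr
        exact_mod_cast h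
    _ = (m : ℝ) ^ (τ / 2) := by
        nth_rw 1 [← Real.rpow_one (m : ℝ)]
        rw [← Real.rpow_add hm']; congr 1; ring

variable {G H K : Type} [Group G] [Group H] [Group K] [Fintype G] [Fintype H] [Fintype K]

/-- The cost of a generalized DFT of `H × K`, with respect to the products of irreducible
representations of the factors: transform along `H`, and then along `K`. -/
theorem cost_dft_prod {κ κ' : Type} [Fintype κ] {e : κ → ℕ} {f : κ' → ℕ}
    {σ : ∀ i, H →* Matrix (Fin (e i)) (Fin (e i)) ℂ}
    {τ : ∀ i, K →* Matrix (Fin (f i)) (Fin (f i)) ℂ} (hσ : IsCompleteIrreps σ)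
    (hτ : IsCompleteIrreps τ) {tH tK : ℝ} (hH : DFTCost H tH) (hK : DFTCost K tK) :
    Cost (fun (c : H × K → ℂ) (p : (Σ a, Fin (e a) × Fin (e a)) × (Σ b, Fin (f b) × Fin (f b))) =>
        dft τ (fun k => dft σ (fun h => c (h, k)) p.1) p.2)
      (Fintype.card K * tH + Fintype.card H * tK) := by
  have c1 : Cost (fun (c : H × K → ℂ) (p : K × (Σ a, Fin (e a) × Fin (e a))) =>
      dft σ (fun h => c (h, p.1)) p.2) (∑ _k : K, (0 + tH)) :=
    Cost.of_family (Z := fun _ => Σ a, Fin (e a) × Fin (e a)) (fun k => (hH _ _ σ hσ).comp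
      (f := fun (c : H × K → ℂ) h => c (h, k)) (Cost.free fun h => .inl ⟨_, fun _ => rfl⟩))
      fun p => ⟨p.1, p.2, fun _ => rfl⟩
  have c2 : Cost (fun (u : K × (Σ a, Fin (e a) × Fin (e a)) → ℂ)
      (p : (Σ a, Fin (e a) × Fin (e a)) × (Σ b, Fin (f b) × Fin (f b))) =>
      dft τ (fun k => u (k, p.1)) p.2) (∑ _r : (Σ a, Fin (e a) × Fin (e a)), (0 + tK)) :=
    Cost.of_family (Z := fun _ => Σ b, Fin (f b) × Fin (f b)) (fun r => (hK _ _ τ hτ).comp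
      (f := fun (u : K × (Σ a, Fin (e a) × Fin (e a)) → ℂ) k => u (k, r))
      (Cost.free fun h => .inl ⟨_, fun _ => rfl⟩)) fun p => ⟨p.1, p.2, fun _ => rfl⟩
  refine (c2.comp c1).mono ?_
  have hle : ((Fintype.card (Σ a, Fin (e a) × Fin (e a)) : ℕ) : ℝ) ≤ Fintype.card H := by
    exact_mod_cast (by simpa [sq] using hσ.sum_sq_le :
      Fintype.card (Σ a, Fin (e a) × Fin (e a)) ≤ Fintype.card H)
  simp only [zero_add, Finset.sum_const, Finset.card_univ, nsmul_eq_mul]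
  have := mul_le_mul_of_nonneg_right hle hK.nonneg
  linarith

/-- The double subgroup reduction. If `G` is covered by the sets `φ(H) s_w ψ(K)`, `w ∈ W`, then an
element of the group algebra is a sum of `|W|` elements, each supported on one of these sets. Such
an element comes from the group algebra of `H × K`, and its image under `ρ`, written in bases
adapted to `H` (rows) and to `K` (columns), is obtained from its `H × K`-transform by multiplying
with fixed matrices, one for each pair of irreducible representations of `H` and `K`. -/
theorem MatMulBound.dftCost_of_cover {τ₀ b : ℝ} (hb : MatMulBound τ₀ b) {φ : H →* G} {ψ : K →* G}
    {W : Type} [Fintype W] {s : W → G} (hs : ∀ g, ∃ h w k, g = φ h * s w * ψ k)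
    {tH tK : ℝ} (hH : DFTCost H tH) (hK : DFTCost K tK) :
    DFTCost G (Fintype.card W * (Fintype.card K * tH + Fintype.card H * tK +
      Fintype.card W * b * ((Fintype.card H * Fintype.card K : ℕ) : ℝ) ^ (τ₀ / 2) +
        Fintype.card G) + 2 * b * (Fintype.card G : ℝ) ^ (τ₀ / 2)) := by
  classical
  intro ι d ρ hρ
  have := hρ.finite
  let _ := Fintype.ofFinite ι
  obtain ⟨κ, e, σ, hσ⟩ := exists_isCompleteIrreps H
  obtain ⟨κ', f, τ, hτ⟩ := exists_isCompleteIrreps K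
  have := hσ.finite
  let _ := Fintype.ofFinite κ
  have := hτ.finite
  let _ := Fintype.ofFinite κ'
  have A i := Classical.choice (hσ.nonempty_splitting ((ρ i).comp φ))
  have B i := Classical.choice (hτ.nonempty_splitting ((ρ i).comp ψ))
  let M (i) (g : G) := (A i).P * ρ i g * (B i).P'
  choose hh ww kk hg using hs
  -- the part of `c` that belongs to the double coset `w`, pulled back to `H × K`
  let part (w : W) (c : G → ℂ) (p : H × K) : ℂ :=
    if hh (φ p.1 * s w * ψ p.2) = p.1 ∧ ww (φ p.1 * s w * ψ p.2) = w ∧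
      kk (φ p.1 * s w * ψ p.2) = p.2 then c (φ p.1 * s w * ψ p.2) else 0
  have hpart (w) : Cost (part w) 0 := Cost.free fun p => by
    by_cases h : hh (φ p.1 * s w * ψ p.2) = p.1 ∧ ww (φ p.1 * s w * ψ p.2) = w ∧
      kk (φ p.1 * s w * ψ p.2) = p.2
    · exact .inl ⟨_, fun c => if_pos h⟩
    · exact .inr ⟨0, fun c => if_neg h⟩
  have hsum (c : G → ℂ) (F : G → ℂ) : ∑ g, c g * F g =
      ∑ w, ∑ h, ∑ k, part w c (h, k) * F (φ h * s w * ψ k) := by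
    simp only [← Fintype.sum_prod_type']
    refine Fintype.sum_of_injective (fun g => (ww g, hh g, kk g)) (fun g g' h => ?_) _ _ ?_ ?_
    · simp only [Prod.mk.injEq] at h
      rw [hg g, hg g', h.1, h.2.1, h.2.2]
    · rintro ⟨w, h, k⟩ hn
      simp only [part]
      rw [if_neg, zero_mul]
      rintro ⟨h1, h2, h3⟩
      exact hn ⟨φ h * s w * ψ k, by simp only [h1, h2, h3]⟩
    · intro g
      simp only [part]
      rw [← hg g, if_pos ⟨rfl, rfl, rfl⟩]
  -- the image of `c` under `ρ i` in the adapted bases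
  have hM (c : G → ℂ) (i a j x b l y) : ∑ g, c g * M i g ⟨a, j, x⟩ ⟨b, l, y⟩ =
      ∑ w, ∑ z : Fin (e a) × Fin (f b), dft τ (fun k => dft σ (fun h => part w c (h, k))
        ⟨a, x, z.1⟩) ⟨b, z.2, y⟩ * M i (s w) ⟨a, j, z.1⟩ ⟨b, l, z.2⟩ := by
    rw [hsum]
    refine Finset.sum_congr rfl fun w _ => ?_
    simp only [M, (A i).equivariant (B i), dft_apply, Finset.mul_sum, Finset.sum_mul,
      Fintype.sum_prod_type]
    rw [Finset.sum_comm]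
    simp only [Finset.sum_comm (s := (Finset.univ : Finset H))]
    rw [Finset.sum_comm]
    refine Finset.sum_congr rfl fun x' _ => ?_
    rw [Finset.sum_comm]
    refine Finset.sum_congr rfl fun y' _ => ?_
    refine Finset.sum_congr rfl fun k _ => ?_
    refine Finset.sum_congr rfl fun h _ => ?_
    ring
  -- one of the products with a fixed matrix, for each pair `q` of irreducible representations
  have hprod (w : W) (q : κ × κ') := ((hb.cost_mul_const (n := e q.1 * f q.2) (N := Fintype.card W)
    (I := Fin (e q.1) × Fin (f q.2)) (J := Fin (e q.1) × Fin (f q.2))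
    (L := Σ i, (A i).J q.1 × (B i).J q.2)
    (Nat.mul_pos (Nat.pos_of_ne_zero (hσ.neZero q.1).out) (Nat.pos_of_ne_zero (hτ.neZero q.2).out))
    (by simp) (by simp) (Splitting.card_le hρ hσ hτ (fun g => ⟨_, _, _, hg g⟩) A B q.1 q.2)
    fun p => M p.2.1 (s w) ⟨q.1, p.2.2.1, p.1.1⟩ ⟨q.2, p.2.2.2, p.1.2⟩).comp
    (Cost.free (f := fun (u : (Σ a, Fin (e a) × Fin (e a)) × (Σ b, Fin (f b) × Fin (f b)) → ℂ) p =>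
      u (⟨q.1, p.1.1, p.2.1⟩, ⟨q.2, p.2.2, p.1.2⟩)) fun p => .inl ⟨_, fun _ => rfl⟩))
  have hblocks (w : W) := (Cost.of_family (hprod w)
    (Y := Σ i, (Σ a, (A i).J a × Fin (e a)) × (Σ b, (B i).J b × Fin (f b)))
    (g := fun u o => ∑ z : Fin (e o.2.1.1) × Fin (f o.2.2.1),
      u (⟨o.2.1.1, o.2.1.2.2, z.1⟩, ⟨o.2.2.1, z.2, o.2.2.2.2⟩) *
        M o.1 (s w) ⟨o.2.1.1, o.2.1.2.1, z.1⟩ ⟨o.2.2.1, o.2.2.2.1, z.2⟩)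
    fun o => ⟨(o.2.1.1, o.2.2.1), ((o.2.1.2.2, o.2.2.2.2), ⟨o.1, o.2.1.2.1, o.2.2.2.1⟩),
      fun _ => rfl⟩).comp ((cost_dft_prod hσ hτ hH hK).comp (hpart w))
  have hZ : Cost (fun (c : G → ℂ)
      (o : Σ i, (Σ a, (A i).J a × Fin (e a)) × (Σ b, (B i).J b × Fin (f b))) =>
      ∑ g, c g * M o.1 g o.2.1 o.2.2) _ :=
    (Cost.sum hblocks).reindex fun o => ⟨o, fun c => hM c _ _ _ _ _ _ _⟩
  -- back to the given bases
  have hback (i : ι) := hb.cost_mul (n := d i) (Nat.pos_of_ne_zero (hρ.neZero i).out)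
    (I := Fin (d i)) (J := Σ b, (B i).J b × Fin (f b)) (L := Fin (d i)) (by simp)
    (B i).card_eq.le (by simp)
    (hb.cost_mul (n := d i) (Nat.pos_of_ne_zero (hρ.neZero i).out)
      (X := (Σ i, (Σ a, (A i).J a × Fin (e a)) × (Σ b, (B i).J b × Fin (f b))))
      (I := Fin (d i)) (J := Σ a, (A i).J a × Fin (e a)) (L := Σ b, (B i).J b × Fin (f b))
      (by simp) (A i).card_eq.le (B i).card_eq.le
      (f := fun _ p => (A i).P' p.1 p.2) (g := fun z p => z ⟨i, p.1, p.2⟩)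
      (Cost.free fun p => .inr ⟨_, fun _ => rfl⟩) (Cost.free fun p => .inl ⟨_, fun _ => rfl⟩))
    (g := fun _ p => (B i).P p.1 p.2) (Cost.free fun p => .inr ⟨_, fun _ => rfl⟩)
  refine ((Cost.of_family hback (Y := Σ i, Fin (d i) × Fin (d i))
    (g := fun z o => ∑ q, (∑ p, (A o.1).P' o.2.1 p * z ⟨o.1, p, q⟩) * (B o.1).P q o.2.2)
    fun o => ⟨o.1, o.2, fun _ => rfl⟩).comp hZ).mono ?_ |>.reindex ?_
  · have hO : ((Fintype.card (Σ i, (Σ a, (A i).J a × Fin (e a)) × (Σ b, (B i).J b × Fin (f b))) : ℕ)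
        : ℝ) ≤ Fintype.card G := by
      have := hρ.sum_sq_le
      rw [Fintype.card_sigma]
      simp only [Fintype.card_prod, (A _).card_eq, (B _).card_eq, ← sq]
      exact_mod_cast this
    have hG := sum_rpow_le Fintype.card_pos hρ.sum_sq_le hb.two_le
    have hHK : ∑ q : κ × κ', ((e q.1 * f q.2 : ℕ) : ℝ) ^ τ₀ ≤
        ((Fintype.card H * Fintype.card K : ℕ) : ℝ) ^ (τ₀ / 2) := by
      have h1 := sum_rpow_le Fintype.card_pos hσ.sum_sq_le hb.two_le
      have h2 := sum_rpow_le Fintype.card_pos hτ.sum_sq_le hb.two_le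
      push_cast
      rw [Fintype.sum_prod_type, Real.mul_rpow (by positivity) (by positivity)]
      calc _ = (∑ a, (e a : ℝ) ^ τ₀) * ∑ b, (f b : ℝ) ^ τ₀ := by
            rw [Finset.sum_mul_sum]
            refine Finset.sum_congr rfl fun _ _ => Finset.sum_congr rfl fun _ _ => ?_
            rw [Real.mul_rpow (by positivity) (by positivity)]
        _ ≤ _ := by gcongr
    have hb0 : 0 ≤ b := by linarith [hb.one_le]
    simp only [zero_add, add_zero, ← Finset.mul_sum, Finset.sum_add_distrib, Finset.sum_const,
      Finset.card_univ, nsmul_eq_mul]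
    have hb1 := mul_le_mul_of_nonneg_left hG hb0
    have hb2 := mul_le_mul_of_nonneg_left (mul_le_mul_of_nonneg_left hHK hb0)
      (Nat.cast_nonneg (α := ℝ) (Fintype.card W))
    have hb3 := mul_le_mul_of_nonneg_left (add_le_add hb2 hO)
      (Nat.cast_nonneg (α := ℝ) (Fintype.card W))
    nlinarith
  · rintro ⟨i, x, y⟩
    refine ⟨⟨i, x, y⟩, fun c => ?_⟩
    have key : (A i).P' * (∑ g, c g • M i g) * (B i).P = ∑ g, c g • ρ i g := by
      rw [Matrix.mul_sum, Matrix.sum_mul]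
      refine Finset.sum_congr rfl fun g _ => ?_
      rw [Matrix.mul_smul, Matrix.smul_mul]
      congr 1
      calc (A i).P' * ((A i).P * ρ i g * (B i).P') * (B i).P
          = ((A i).P' * (A i).P) * ρ i g * ((B i).P' * (B i).P) := by
            simp only [Matrix.mul_assoc]
        _ = ρ i g := by
            rw [(A i).P'_mul_P, (B i).P'_mul_P, Matrix.one_mul, Matrix.mul_one]
    rw [dft, ← key]
    change ((A i).P' * (∑ g, c g • M i g) * (B i).P) x y = _
    rw [Matrix.mul_apply]
    refine Finset.sum_congr rfl fun q _ => ?_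
    rw [Matrix.mul_apply]
    congr 1
    refine Finset.sum_congr rfl fun p _ => ?_
    rw [Matrix.sum_apply]
    rfl

end Reduction

/-! ### Groups that are products of cyclic subgroups -/

section DFTBound

theorem DFTCost.of_mulEquiv {G H : Type} [Group G] [Group H] [Fintype G] [Fintype H] (θ : G ≃* H)
    {s : ℝ} (h : DFTCost H s) : DFTCost G s := by
  intro ι d ρ hρ
  let ρ' i : H →* Matrix (Fin (d i)) (Fin (d i)) ℂ := (ρ i).comp (θ.symm : H →* G)
  have hρ' : IsCompleteIrreps ρ' := by
    refine ⟨fun i => isIrreducible_of_equiv (LinearEquiv.refl ℂ _) θ.symm θ.symm.surjective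
      (fun _ _ => rfl) (hρ.irreducible i), fun i j => ?_, fun m σ hσ => ?_⟩
    · rintro ⟨E⟩
      refine hρ.inequivalent i j ⟨.mk E.toLinearEquiv fun g => LinearMap.ext fun v => ?_⟩
      have := Representation.IntertwiningMap.isIntertwining _ _ E.toIntertwiningMap (θ g) v
      simpa [ρ', toRep_apply] using this
    · obtain ⟨i, ⟨E⟩⟩ := hρ.complete m (σ.comp (θ : G →* H)) (isIrreducible_of_equiv
        (LinearEquiv.refl ℂ _) θ θ.surjective (fun _ _ => rfl) hσ)
      refine ⟨i, ⟨.mk E.toLinearEquiv fun g => LinearMap.ext fun v => ?_⟩⟩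
      have := Representation.IntertwiningMap.isIntertwining _ _ E.toIntertwiningMap (θ.symm g) v
      simpa [ρ', toRep_apply] using this
  refine (((h ι d ρ' hρ').comp (f := fun (c : G → ℂ) x => c (θ.symm x))
    (Cost.free fun x => .inl ⟨_, fun _ => rfl⟩)).mono (by simp)).reindex ?_
  rintro ⟨i, x, y⟩
  refine ⟨⟨i, x, y⟩, fun c => ?_⟩
  rw [dft_apply, dft_apply]
  exact Fintype.sum_equiv θ.toEquiv _ _ fun g => by simp [ρ']

/-- The bound on generalized DFTs that is proved for products of cyclic groups. The factor
`2 log |G| - 1` satisfies `(2 log |H| - 1) + (2 log |K| - 1) + 1 = 2 log (|H| |K|) - 1`, which leaves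
room for the cost of the reduction of a product to its factors. The constant is
large enough for cyclic groups. The trivial group is an exception. -/
def DFTBound (τ b : ℝ) (G : Type) [Group G] : Prop :=
  Nat.card G = 1 ∨ ∀ _ : Fintype G, DFTCost G
    (54 * b * (2 * Real.logb 2 (Nat.card G) - 1) * (Nat.card G : ℝ) ^ (τ / 2))

variable {τ b : ℝ}

theorem one_le_logb_card {G : Type} [Group G] [Finite G] (h : Nat.card G ≠ 1) :
    1 ≤ Real.logb 2 (Nat.card G) := by
  have h2 : 2 ≤ Nat.card G := by have := Nat.card_pos (α := G); lia
  rw [Real.le_logb_iff_rpow_le one_lt_two (by positivity), Real.rpow_one]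
  exact_mod_cast h2

theorem self_le_rpow {m : ℕ} (hm : 1 ≤ m) (hτ : 2 ≤ τ) : (m : ℝ) ≤ (m : ℝ) ^ (τ / 2) :=
  Real.self_le_rpow_of_one_le (by exact_mod_cast hm) (by linarith)

theorem DFTBound.of_mulEquiv {G H : Type} [Group G] [Group H] (θ : G ≃* H)
    (h : DFTBound τ b H) : DFTBound τ b G := by
  rw [DFTBound, Nat.card_congr θ.toEquiv]
  refine h.imp id fun h _ => ?_
  let _ : Fintype H := Fintype.ofEquiv G θ.toEquiv
  exact (h _).of_mulEquiv θ

theorem MatMulBound.dftBound_of_isCyclic (hb : MatMulBound τ b) (G : Type) [Group G] [Finite G]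
    [IsCyclic G] : DFTBound τ b G := by
  by_cases h : Nat.card G = 1
  · exact .inl h
  refine .inr fun _ ι d ρ hρ => (dftCost_of_isCyclic G ι d ρ hρ).mono ?_
  rw [← Nat.card_eq_fintype_card]
  have h1 := one_le_logb_card h
  have h2 := self_le_rpow (Nat.card_pos (α := G)) hb.two_le
  have hb1 := hb.one_le
  set L := Real.logb 2 (Nat.card G)
  calc (Nat.card G : ℝ) * (38 + 16 * L) ≤ (Nat.card G : ℝ) ^ (τ / 2) * (54 * b * (2 * L - 1)) := by
        gcongr
        nlinarith
    _ = _ := by ring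

/-- A group in which every element is uniquely a product of elements of (the images of) `H` and
`K`. -/
theorem MatMulBound.dftBound_of_bijective (hb : MatMulBound τ b) {G H K : Type} [Group G]
    [Group H] [Group K] [Finite G] {φ : H →* G} {ψ : K →* G}
    (hbij : Function.Bijective fun p : H × K => φ p.1 * ψ p.2) (hH : DFTBound τ b H)
    (hK : DFTBound τ b K) : DFTBound τ b G := by
  have hφ : Function.Injective φ := fun h h' e => by
    simpa using hbij.1 (a₁ := (h, 1)) (a₂ := (h', 1)) (by simpa using e)
  have hψ : Function.Injective ψ := fun k k' e => by
    simpa using hbij.1 (a₁ := (1, k)) (a₂ := (1, k')) (by simpa using e)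
  have := Finite.of_injective φ hφ
  have := Finite.of_injective ψ hψ
  by_cases hH1 : Nat.card H = 1
  · refine hK.of_mulEquiv (MulEquiv.ofBijective ψ ⟨hψ, fun g => ?_⟩).symm
    obtain ⟨⟨h, k⟩, rfl⟩ := hbij.2 g
    have := (Nat.card_eq_one_iff_unique.1 hH1).1
    exact ⟨k, by simp [Subsingleton.elim h 1]⟩
  by_cases hK1 : Nat.card K = 1
  · refine hH.of_mulEquiv (MulEquiv.ofBijective φ ⟨hφ, fun g => ?_⟩).symm
    obtain ⟨⟨h, k⟩, rfl⟩ := hbij.2 g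
    have := (Nat.card_eq_one_iff_unique.1 hK1).1
    exact ⟨h, by simp [Subsingleton.elim k 1]⟩
  refine .inr fun _ => ?_
  have := Fintype.ofFinite H
  have := Fintype.ofFinite K
  have hcard : Nat.card H * Nat.card K = Nat.card G := by
    rw [← Nat.card_prod]; exact Nat.card_congr (Equiv.ofBijective _ hbij)
  have key := hb.dftCost_of_cover (φ := φ) (ψ := ψ) (W := Unit) (s := fun _ => 1)
    (fun g => by
      obtain ⟨⟨h, k⟩, rfl⟩ := hbij.2 g
      exact ⟨h, (), k, by simp⟩)
    (hH.resolve_left hH1 _) (hK.resolve_left hK1 _)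
  intro ι d ρ hρ
  refine (key ι d ρ hρ).mono ?_
  rw [Fintype.card_unit]
  simp only [← Nat.card_eq_fintype_card, hcard]
  have l1 := one_le_logb_card hH1
  have l2 := one_le_logb_card hK1
  have c1 := self_le_rpow (Nat.card_pos (α := H)) hb.two_le
  have c2 := self_le_rpow (Nat.card_pos (α := K)) hb.two_le
  have c3 := self_le_rpow (Nat.card_pos (α := G)) hb.two_le
  have hb1 := hb.one_le
  have hlog : Real.logb 2 (Nat.card G) = Real.logb 2 (Nat.card H) + Real.logb 2 (Nat.card K) := by
    rw [← hcard, Nat.cast_mul, Real.logb_mul] <;>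
      exact_mod_cast Nat.card_pos.ne'
  have hpow : (Nat.card G : ℝ) ^ (τ / 2) =
      (Nat.card H : ℝ) ^ (τ / 2) * (Nat.card K : ℝ) ^ (τ / 2) := by
    rw [← hcard, Nat.cast_mul, Real.mul_rpow (by positivity) (by positivity)]
  rw [hlog]
  set L₁ := Real.logb 2 (Nat.card H)
  set L₂ := Real.logb 2 (Nat.card K)
  set X₁ := (Nat.card H : ℝ) ^ (τ / 2)
  set X₂ := (Nat.card K : ℝ) ^ (τ / 2)
  have hX₁ : 0 ≤ X₁ := by positivity
  have hX₂ : 0 ≤ X₂ := by positivity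
  rw [hpow] at c3 ⊢
  have t1 : (Nat.card K : ℝ) * (54 * b * (2 * L₁ - 1) * X₁) ≤ X₂ * (54 * b * (2 * L₁ - 1) * X₁) :=
    mul_le_mul_of_nonneg_right c2 (mul_nonneg (mul_nonneg (by linarith) (by linarith)) hX₁)
  have t2 : (Nat.card H : ℝ) * (54 * b * (2 * L₂ - 1) * X₂) ≤ X₁ * (54 * b * (2 * L₂ - 1) * X₂) :=
    mul_le_mul_of_nonneg_right c1 (mul_nonneg (mul_nonneg (by linarith) (by linarith)) hX₂)
  have t3 : X₁ * X₂ ≤ b * (X₁ * X₂) := le_mul_of_one_le_left (mul_nonneg hX₁ hX₂) hb1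
  have t4 : 0 ≤ b * (X₁ * X₂) := mul_nonneg (by linarith) (mul_nonneg hX₁ hX₂)
  push_cast
  linarith

theorem MatMulBound.dftBound_pi_fin (hb : MatMulBound τ b) (m : ℕ) (C : Fin m → Type)
    [∀ i, Group (C i)] [∀ i, Finite (C i)] [∀ i, IsCyclic (C i)] : DFTBound τ b (∀ i, C i) := by
  induction m with
  | zero => exact .inl (Nat.card_eq_one_iff_unique.2 ⟨inferInstance, inferInstance⟩)
  | succ m ih =>
    let φ : (∀ i : Fin m, C i.succ) →* ∀ i, C i :=
      { toFun := fun f => Fin.cons 1 f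
        map_one' := by funext i; refine Fin.cases ?_ (fun _ => ?_) i <;> simp
        map_mul' := fun f g => by funext i; refine Fin.cases ?_ (fun _ => ?_) i <;> simp }
    refine hb.dftBound_of_bijective (φ := φ) (ψ := MonoidHom.mulSingle C 0) ⟨?_, fun f => ?_⟩
      (ih fun i => C i.succ) (hb.dftBound_of_isCyclic (C 0))
    · rintro ⟨f, a⟩ ⟨f', a'⟩ h
      have h0 := congrFun h 0
      have hs i := congrFun h (Fin.succ i)
      simp [φ] at h0 hs
      exact Prod.ext (funext hs) h0
    · refine ⟨(fun i => f i.succ, f 0), ?_⟩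
      funext i
      refine Fin.cases ?_ (fun _ => ?_) i <;> simp [φ]

theorem MatMulBound.dftBound_of_comm (hb : MatMulBound τ b) (G : Type) [Group G] [Finite G]
    (hG : ∀ x y : G, x * y = y * x) : DFTBound τ b G := by
  let _ : CommGroup G := { ‹Group G› with mul_comm := hG }
  obtain ⟨ι, _, n, hn, ⟨θ⟩⟩ := CommGroup.equiv_prod_multiplicative_zmod_of_finite G
  have hne (i : ι) : NeZero (n i) := ⟨(zero_lt_one.trans (hn i)).ne'⟩
  let C (i : ι) := Multiplicative (ZMod (n i))
  have hC (i : ι) : Finite (C i) := inferInstanceAs (Finite (ZMod (n i)))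
  let E := Fintype.equivFin ι
  let θ' : (∀ i, C i) ≃* ∀ j, C (E.symm j) :=
    { Equiv.piCongrLeft' C E with map_mul' := fun _ _ => rfl }
  exact (hb.dftBound_pi_fin _ fun j => C (E.symm j)).of_mulEquiv (θ.trans θ')

theorem MatMulBound.dftBound_of_subgroups (hb : MatMulBound τ b) {Γ : Type} [Group Γ] [Finite Γ]
    {H K L : Subgroup Γ} (hHL : H ≤ L) (hKL : K ≤ L) (hL : ∀ g ∈ L, ∃ h ∈ H, ∃ k ∈ K, h * k = g)
    (hHK : H ⊓ K = ⊥) (hH : DFTBound τ b H) (hK : DFTBound τ b K) : DFTBound τ b L := by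
  refine hb.dftBound_of_bijective (φ := Subgroup.inclusion hHL) (ψ := Subgroup.inclusion hKL)
    ⟨?_, ?_⟩ hH hK
  · have := Subgroup.mul_injective_of_disjoint (disjoint_iff.2 hHK)
    exact fun p q h => this (congrArg Subtype.val h)
  · rintro ⟨g, hg⟩
    obtain ⟨h, hh, k, hk, rfl⟩ := hL g hg
    exact ⟨(⟨h, hh⟩, ⟨k, hk⟩), rfl⟩

/-- The bound with a factor that also covers the trivial group. -/
theorem DFTBound.dftCost (hb : MatMulBound τ b) {G : Type} [Group G] [Fintype G]
    (h : DFTBound τ b G) :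
    DFTCost G (54 * b * (2 * Real.logb 2 (Nat.card G) + 1) * (Nat.card G : ℝ) ^ (τ / 2)) := by
  intro ι d ρ hρ
  have hb1 := hb.one_le
  obtain h1 | h := h
  · have : Subsingleton G := (Nat.card_eq_one_iff_unique.1 h1).1
    refine (dftCost_of_isCyclic G ι d ρ hρ).mono ?_
    rw [← Nat.card_eq_fintype_card, h1]
    norm_num
    linarith
  · refine (h _ ι d ρ hρ).mono ?_
    gcongr
    linarith

end DFTBound

/-! ### The general linear group: Borel subgroup and Bruhat decomposition -/

section GeneralLinear

open Matrix

variable {n : ℕ} {F : Type} [Field F]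

/-- The group of invertible matrices that differ from the identity matrix only at positions
in `R`. -/
def patternSubgroup [Finite F] (R : Fin n → Fin n → Prop) (hR : ∀ i j k, R i j → R j k → R i k) :
    Subgroup (GL (Fin n) F) :=
  let S : Submonoid (GL (Fin n) F) :=
    { carrier := {g | ∀ i j, ¬ R i j → g.1 i j = (1 : Matrix (Fin n) (Fin n) F) i j}
      one_mem' := fun _ _ _ => rfl
      mul_mem' := by
        intro g h hg hh i j hij
        change (g.1 * h.1) i j = _
        rw [Matrix.mul_apply]
        by_cases hij' : i = j
        · subst hij'
          rw [Finset.sum_eq_single i]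
          · rw [hg i i hij, hh i i hij]; simp
          · intro k _ hk
            by_cases h1 : R i k
            · rw [hh k i (fun h2 => hij (hR _ _ _ h1 h2)), one_apply_ne hk, mul_zero]
            · rw [hg i k h1, one_apply_ne hk.symm, zero_mul]
          · simp
        · rw [one_apply_ne hij']
          refine Finset.sum_eq_zero fun k _ => ?_
          by_cases hik : i = k
          · subst hik
            rw [hh i j hij, one_apply_ne hij', mul_zero]
          by_cases h1 : R i k
          · by_cases hkj : k = j
            · subst hkj; exact absurd h1 hij
            · rw [hh k j (fun h2 => hij (hR _ _ _ h1 h2)), one_apply_ne hkj, mul_zero]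
          · rw [hg i k h1, one_apply_ne hik, zero_mul] }
  { S with
    inv_mem' := by
      intro g hg
      have h1 : g⁻¹ ∈ Submonoid.powers g :=
        (isOfFinOrder_of_finite g).mem_powers_iff_mem_zpowers.2
          (inv_mem (Subgroup.mem_zpowers g))
      exact (Submonoid.powers_le (P := S)).2 hg h1 }

theorem exists_gl_of_upperTriangular {M : Matrix (Fin n) (Fin n) F}
    (h : ∀ i j, j < i → M i j = 0) (h' : ∀ i, M i i ≠ 0) : ∃ g : GL (Fin n) F, g.1 = M := by
  have hdet : M.det ≠ 0 := by
    rw [Matrix.det_of_isUpperTriangular (fun i j hij => h i j hij)]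
    exact Finset.prod_ne_zero_iff.2 fun i _ => h' i
  exact ⟨GeneralLinearGroup.mkOfDetNeZero M hdet, rfl⟩

variable [Finite F]

theorem patternSubgroup_inf_eq_bot {R R' : Fin n → Fin n → Prop} {hR hR'}
    (h : ∀ i j, R i j → ¬ R' i j) :
    patternSubgroup (F := F) R hR ⊓ patternSubgroup R' hR' = ⊥ := by
  rw [eq_bot_iff]
  rintro g ⟨h1, h2⟩
  refine Units.ext (Matrix.ext fun i j => ?_)
  by_cases hij : R i j
  · exact h2 i j (h i j hij)
  · exact h1 i j hij

theorem patternSubgroup_mono {R R' : Fin n → Fin n → Prop} {hR hR'}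
    (h : ∀ i j, R i j → R' i j) : patternSubgroup (F := F) R hR ≤ patternSubgroup R' hR' :=
  fun _ hg i j hij => hg i j fun h' => hij (h i j h')

variable (n F) in
/-- Upper unitriangular matrices with trivial rows above row `r`. -/
def unipotent (r : ℕ) : Subgroup (GL (Fin n) F) :=
  patternSubgroup (fun i j => r ≤ (i : ℕ) ∧ i < j) fun _ _ _ h h' => ⟨h.1, h.2.trans h'.2⟩

variable (n F) in
/-- Upper unitriangular matrices that differ from the identity matrix only in row `r`. -/
def unipotentRow (r : ℕ) : Subgroup (GL (Fin n) F) :=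
  patternSubgroup (fun i j => (i : ℕ) = r ∧ i < j) fun _ _ _ h h' => ⟨h.1, h.2.trans h'.2⟩

variable (n F) in
/-- Invertible diagonal matrices. -/
def torus : Subgroup (GL (Fin n) F) :=
  patternSubgroup (fun i j => i = j) fun _ _ _ h h' => h.trans h'

variable (n F) in
/-- Invertible upper triangular matrices. -/
def borel : Subgroup (GL (Fin n) F) :=
  patternSubgroup (fun i j => i ≤ j) fun _ _ _ h h' => h.trans h'

variable (n F) in
/-- Lower unitriangular matrices. -/
def lowerUnipotent : Subgroup (GL (Fin n) F) :=
  patternSubgroup (fun i j => j < i) fun _ _ _ h h' => h'.trans h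

theorem diag_ne_zero_of_mem_borel {g : GL (Fin n) F} (hg : g ∈ borel n F) (i : Fin n) :
    g.1 i i ≠ 0 := by
  have h : g.1.det ≠ 0 := by
    have := (Matrix.isUnit_iff_isUnit_det _).1 g.isUnit
    exact this.ne_zero
  rw [Matrix.det_of_isUpperTriangular (fun i j hij => (hg i j (not_le.2 hij)).trans
    (one_apply_ne (ne_of_gt hij)))] at h
  exact Finset.prod_ne_zero_iff.1 h i (Finset.mem_univ i)

variable {τ b : ℝ}

theorem dftBound_unipotentRow (hb : MatMulBound τ b) (r : ℕ) :
    DFTBound τ b (unipotentRow n F r) := by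
  refine hb.dftBound_of_comm _ ?_
  have key (g h : unipotentRow n F r) : g.1.1 * h.1.1 = g.1.1 + h.1.1 - 1 := by
    have h0 : (g.1.1 - 1) * (h.1.1 - 1) = 0 := by
      ext i j
      rw [Matrix.mul_apply]
      refine Finset.sum_eq_zero fun k _ => ?_
      by_cases hik : (i : ℕ) = r ∧ i < k
      · rw [Matrix.sub_apply h.1.1, h.2 k j (fun hk => by
          have := Fin.lt_def.1 hik.2; lia), sub_self, mul_zero]
      · rw [Matrix.sub_apply, g.2 i k hik, sub_self, zero_mul]
    have h1 : g.1.1 * h.1.1 = (g.1.1 - 1) * (h.1.1 - 1) + (g.1.1 + h.1.1 - 1) := by noncomm_ring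
    rw [h1, h0, zero_add]
  intro g h
  refine Subtype.ext (Units.ext ?_)
  change g.1.1 * h.1.1 = h.1.1 * g.1.1
  rw [key, key, add_comm g.1.1]

/-- The unitriangular group is built up row by row. -/
theorem dftBound_unipotent (hb : MatMulBound τ b) (r : ℕ) : DFTBound τ b (unipotent n F r) := by
  induction hk : n - r generalizing r with
  | zero =>
    refine .inl ?_
    have : unipotent n F r = ⊥ := by
      rw [eq_bot_iff]
      exact fun g hg => Units.ext (Matrix.ext fun i j => hg i j (by lia))
    rw [this]
    exact Subgroup.card_bot
  | succ k ih =>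
    refine hb.dftBound_of_subgroups (H := unipotent n F (r + 1)) (K := unipotentRow n F r)
      (patternSubgroup_mono fun i j h => ⟨by lia, h.2⟩)
      (patternSubgroup_mono fun i j h => ⟨h.1.ge, h.2⟩) (fun g hg => ?_)
      (patternSubgroup_inf_eq_bot fun i j h h' => by lia)
      (ih (r + 1) (by lia)) (dftBound_unipotentRow hb r)
    have hrow (i : Fin n) (j : Fin n) (hj : j ≤ i) : g.1 i j = (1 : Matrix (Fin n) (Fin n) F) i j :=
      hg i j fun h => absurd h.2 (not_lt.2 hj)
    obtain ⟨x, hx⟩ := exists_gl_of_upperTriangular (F := F)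
      (M := Matrix.of fun i j => if r < (i : ℕ) then g.1 i j else (1 : Matrix (Fin n) (Fin n) F) i j)
      (fun i j hij => by
        have h0 : (1 : Matrix (Fin n) (Fin n) F) i j = 0 := one_apply_ne (ne_of_gt hij)
        simp [hrow i j hij.le, h0])
      (fun i => by simp [hrow i i le_rfl])
    obtain ⟨y, hy⟩ := exists_gl_of_upperTriangular (F := F)
      (M := Matrix.of fun i j => if r = (i : ℕ) then g.1 i j else (1 : Matrix (Fin n) (Fin n) F) i j)
      (fun i j hij => by
        have h0 : (1 : Matrix (Fin n) (Fin n) F) i j = 0 := one_apply_ne (ne_of_gt hij)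
        simp [hrow i j hij.le, h0])
      (fun i => by simp [hrow i i le_rfl])
    have hxm : x ∈ unipotent n F (r + 1) := by
      intro i j hij
      rw [hx, Matrix.of_apply]
      split_ifs with h
      · exact hg i j fun h' => hij ⟨h, h'.2⟩
      · rfl
    have hym : y ∈ unipotentRow n F r := by
      intro i j hij
      rw [hy, Matrix.of_apply]
      split_ifs with h
      · exact hg i j fun h' => hij ⟨h.symm, h'.2⟩
      · rfl
    refine ⟨x, hxm, y, hym, Units.ext ?_⟩
    have h0 : (x.1 - 1) * (y.1 - 1) = 0 := by
      ext i j
      rw [Matrix.mul_apply]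
      refine Finset.sum_eq_zero fun k _ => ?_
      by_cases hik : r + 1 ≤ (i : ℕ) ∧ i < k
      · rw [Matrix.sub_apply y.1, hym k j (fun hk => by
          have := Fin.lt_def.1 hik.2; lia), sub_self, mul_zero]
      · rw [Matrix.sub_apply, hxm i k hik, sub_self, zero_mul]
    have h1 : x.1 * y.1 = (x.1 - 1) * (y.1 - 1) + (x.1 + y.1 - 1) := by noncomm_ring
    change x.1 * y.1 = g.1
    rw [h1, h0, zero_add, hx, hy]
    ext i j
    simp only [Matrix.sub_apply, Matrix.add_apply, Matrix.of_apply]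
    rcases lt_trichotomy r (i : ℕ) with h | h | h
    · rw [if_pos h, if_neg h.ne]; ring
    · rw [if_neg h.not_lt, if_pos h]; ring
    · rw [if_neg h.not_gt, if_neg h.ne', hg i j (fun h' => by lia)]; ring

theorem dftBound_torus (hb : MatMulBound τ b) : DFTBound τ b (torus n F) := by
  refine hb.dftBound_of_comm _ fun g h => Subtype.ext (Units.ext ?_)
  have key (g : torus n F) : g.1.1 = diagonal fun i => g.1.1 i i := by
    ext i j
    by_cases hij : i = j
    · subst hij; simp
    · rw [g.2 i j hij, one_apply_ne hij, diagonal_apply_ne _ hij]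
  change g.1.1 * h.1.1 = h.1.1 * g.1.1
  rw [key g, key h, diagonal_mul_diagonal, diagonal_mul_diagonal]
  simp only [mul_comm]

theorem dftBound_borel (hb : MatMulBound τ b) : DFTBound τ b (borel n F) := by
  refine hb.dftBound_of_subgroups (H := unipotent n F 0) (K := torus n F)
    (patternSubgroup_mono fun i j h => h.2.le) (patternSubgroup_mono fun i j h => h.le)
    (fun g hg => ?_) (patternSubgroup_inf_eq_bot fun i j h h' => h.2.ne h')
    (dftBound_unipotent hb 0) (dftBound_torus hb)
  have hd := diag_ne_zero_of_mem_borel hg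
  have hlow (i j : Fin n) (hij : j < i) : g.1 i j = 0 :=
    (hg i j (not_le.2 hij)).trans (one_apply_ne (ne_of_gt hij))
  obtain ⟨t, ht⟩ := exists_gl_of_upperTriangular (M := diagonal fun i => g.1 i i)
    (fun i j hij => diagonal_apply_ne _ (ne_of_gt hij)) (fun i => by simpa using hd i)
  obtain ⟨u, hu⟩ := exists_gl_of_upperTriangular (M := Matrix.of fun i j => g.1 i j * (g.1 j j)⁻¹)
    (fun i j hij => by simp [hlow i j hij]) (fun i => by simp [hd i])
  refine ⟨u, fun i j hij => ?_, t, fun i j hij => ?_, Units.ext ?_⟩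
  · rw [hu, Matrix.of_apply]
    rcases eq_or_ne i j with rfl | h
    · rw [mul_inv_cancel₀ (hd i), one_apply_eq]
    · rw [hlow i j (lt_of_le_of_ne (not_lt.1 fun h' => hij ⟨Nat.zero_le _, h'⟩) h.symm), zero_mul,
        one_apply_ne h]
  · rw [ht, diagonal_apply_ne _ hij, one_apply_ne hij]
  · change u.1 * t.1 = g.1
    rw [hu, ht]
    ext i j
    rw [mul_diagonal, Matrix.of_apply, inv_mul_cancel_right₀ (hd j)]

/-- The product of the orders of the unitriangular group and of the Borel subgroup is at most the
order of the general linear group, because the opposite of the former meets the latter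
trivially. -/
theorem card_unipotent_mul_card_borel_le :
    Nat.card (unipotent n F 0) * Nat.card (borel n F) ≤ Nat.card (GL (Fin n) F) := by
  have h1 : Nat.card (unipotent n F 0) ≤ Nat.card (lowerUnipotent n F) := by
    let tr (u : unipotent n F 0) : lowerUnipotent n F := ⟨⟨u.1.1ᵀ, u.1⁻¹.1ᵀ, by
        rw [← transpose_mul, ← Units.val_mul, inv_mul_cancel, Units.val_one, transpose_one], by
        rw [← transpose_mul, ← Units.val_mul, mul_inv_cancel, Units.val_one, transpose_one]⟩,
      fun i j hij => by
        change u.1.1 j i = _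
        rw [u.2 j i (fun h => hij h.2), one_apply, one_apply]
        simp only [eq_comm]⟩
    refine Nat.card_le_card_of_injective tr fun u v h => Subtype.ext (Units.ext ?_)
    exact transpose_injective (congrArg (fun x : lowerUnipotent n F => x.1.1) h)
  refine (Nat.mul_le_mul_right _ h1).trans ?_
  rw [← Nat.card_prod]
  exact Nat.card_le_card_of_injective _ (Subgroup.mul_injective_of_disjoint
    (disjoint_iff.2 (patternSubgroup_inf_eq_bot (F := F) (n := n) fun i j h => not_le.2 h)))

/-- Gaussian elimination without row exchanges. When the columns before column `r` are reduced, the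
lowest nonzero entry of column `r` is used to clear the entries above it, which is a multiplication
by a unitriangular matrix from the left, and the entries to its right, which is a multiplication by
an upper triangular matrix from the right. -/
theorem exists_reduced_columns (g : GL (Fin n) F) (r : ℕ) (hr : r ≤ n) :
    ∃ u ∈ unipotent n F 0, ∃ b ∈ borel n F, ∃ π : Fin n → Fin n, ∀ j : Fin n, (j : ℕ) < r →
      (∀ i, (u * g * b).1 i j = if i = π j then 1 else 0) ∧
        ∀ j', (u * g * b).1 (π j) j' = if j' = j then 1 else 0 := by
  classical
  induction r with
  | zero => exact ⟨1, one_mem _, 1, one_mem _, id, fun j hj => absurd hj (Nat.not_lt_zero _)⟩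
  | succ r ih =>
    obtain ⟨u, hu, b, hb, π, hπ⟩ := ih (by lia)
    set m := (u * g * b).1 with hm
    let c : Fin n := ⟨r, hr⟩
    have hne : (Finset.univ.filter fun i => m i c ≠ 0).Nonempty := by
      by_contra h
      rw [Finset.not_nonempty_iff_eq_empty, Finset.filter_eq_empty_iff] at h
      have h0 : m.det = 0 := det_eq_zero_of_column_eq_zero c fun i => by
        simpa using h (Finset.mem_univ i)
      exact ((Matrix.isUnit_iff_isUnit_det _).1 (u * g * b).isUnit).ne_zero h0
    obtain ⟨p, hp, hmax⟩ := Finset.exists_max_image _ id hne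
    have hpc : m p c ≠ 0 := (Finset.mem_filter.1 hp).2
    have hbelow (i) (hi : p < i) : m i c = 0 := by
      by_contra h
      exact absurd (hmax i (Finset.mem_filter.2 ⟨Finset.mem_univ _, h⟩)) (not_le.2 hi)
    have hπc (j : Fin n) (hj : j < c) : m (π j) c = 0 := by
      rw [(hπ j hj).2 c, if_neg (ne_of_gt hj)]
    have hpπ (j : Fin n) (hj : j < c) : p ≠ π j := fun h => hpc (h ▸ hπc j hj)
    have hprow (j : Fin n) (hj : j < c) : m p j = 0 := by
      rw [(hπ j hj).1 p, if_neg (hpπ j hj)]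
    -- the rank one updates `1 + α e_pᵀ` and `1 + e_c βᵀ` perform the row and column operations
    -- the rank one updates `1 + α e_pᵀ` and `1 + e_c βᵀ` perform the row and column operations
    let α (i : Fin n) : F := if i < p then -(m i c / m p c) else 0
    let β (j : Fin n) : F := if j = c then (m p c)⁻¹ - 1 else if c < j then -(m p j / m p c) else 0
    let U : Matrix (Fin n) (Fin n) F := Matrix.of fun i k =>
      (1 : Matrix (Fin n) (Fin n) F) i k + if k = p then α i else 0
    let B : Matrix (Fin n) (Fin n) F := Matrix.of fun k j =>
      (1 : Matrix (Fin n) (Fin n) F) k j + if k = c then β j else 0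
    have hU (i k : Fin n) (h : ¬ i < k) : U i k = (1 : Matrix (Fin n) (Fin n) F) i k := by
      simp only [U, Matrix.of_apply]
      split_ifs with hk
      · subst hk; simp [α, h]
      · simp
    have hB (k j : Fin n) (h : j < k) : B k j = 0 := by
      simp only [B, Matrix.of_apply, one_apply_ne (ne_of_gt h), zero_add]
      split_ifs with hk
      · subst hk; simp [β, h.ne, h.not_gt]
      · rfl
    obtain ⟨u', hu'⟩ := exists_gl_of_upperTriangular (M := U)
      (fun i k h => (hU i k h.not_gt).trans (one_apply_ne (ne_of_gt h)))
      (fun i => by rw [hU i i (lt_irrefl i)]; simp)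
    obtain ⟨b', hb'⟩ := exists_gl_of_upperTriangular (M := B) hB (fun i => by
      simp only [B, Matrix.of_apply, one_apply_eq]
      split_ifs with h
      · subst h; simp [β, hpc]
      · simp)
    have hform (i j : Fin n) : (u' * u * g * (b * b')).1 i j =
        m i j + α i * m p j + (m i c + α i * m p c) * β j := by
      have h1 : (u' * u * g * (b * b')).1 = U * m * B := by
        rw [← hu', ← hb', hm]
        simp only [← Units.val_mul, mul_assoc]
      have h2 (k) : (U * m) i k = m i k + α i * m p k := by
        rw [Matrix.mul_apply]
        simp [U, add_mul, Finset.sum_add_distrib, one_apply]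
      rw [h1, Matrix.mul_apply]
      simp [B, mul_add, Finset.sum_add_distrib, h2, one_apply]
    refine ⟨u' * u, mul_mem (fun i k h => ?_) hu, b * b', mul_mem hb (fun k j h => ?_),
      Function.update π c p, fun j hj => ?_⟩
    · rw [hu', hU i k fun h' => h ⟨Nat.zero_le _, h'⟩]
    · rw [hb', hB k j (not_le.1 h), one_apply_ne (ne_of_gt (not_le.1 h))]
    · have hαp : α p = 0 := by simp [α]
      rcases eq_or_ne j c with rfl | hjc
      · have hβ : 1 + β c = (m p c)⁻¹ := by simp [β]
        simp only [Function.update_self, hform]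
        refine ⟨fun i => ?_, fun j' => ?_⟩
        · have : m i c + α i * m p c + (m i c + α i * m p c) * β c =
              (m i c + α i * m p c) * (m p c)⁻¹ := by rw [← hβ]; ring
          rw [this]
          rcases lt_trichotomy i p with h | rfl | h
          · rw [if_neg h.ne]
            simp only [α, if_pos h]
            field_simp
            ring
          · rw [hαp, if_pos rfl]
            field_simp
            ring
          · rw [if_neg (ne_of_gt h), hbelow i h]
            simp [α, h.not_gt]
        · rw [hαp]
          rcases lt_trichotomy j' c with h | rfl | h
          · rw [if_neg h.ne, hprow j' h]
            simp [β, h.ne, h.not_gt]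
          · rw [if_pos rfl]
            simp [β, hpc, mul_sub]
          · rw [if_neg (ne_of_gt h)]
            simp only [β, if_neg (ne_of_gt h), if_pos h]
            field_simp
            ring
      · have hj' : j < c := lt_of_le_of_ne (Nat.lt_succ_iff.1 hj) hjc
        rw [Function.update_of_ne hjc]
        refine ⟨fun i => ?_, fun j' => ?_⟩
        · have hβ : β j = 0 := by simp [β, hjc, hj'.not_gt]
          rw [hform, hβ, hprow j hj', mul_zero, mul_zero, add_zero, add_zero, (hπ j hj').1 i]
        · have hα : α (π j) = 0 := by simp [α, hπc j hj']
          rw [hform, hα, hπc j hj', zero_mul, zero_mul, add_zero, add_zero, zero_mul, add_zero,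
            (hπ j hj').2 j']

open Classical in
/-- The permutation matrix of `π : Fin n → Fin n` (or `1` if `π` is not a permutation). -/
noncomputable def permElement (π : Fin n → Fin n) : GL (Fin n) F :=
  if h : ∃ w : GL (Fin n) F, w.1 = Matrix.of fun i j => if i = π j then 1 else 0 then h.choose else 1

/-- The Bruhat decomposition (with maps `Fin n → Fin n` in place of permutations). -/
theorem exists_bruhat (g : GL (Fin n) F) : ∃ (u : unipotent n F 0) (π : Fin n → Fin n)
    (b : borel n F), g = (u : GL (Fin n) F) * permElement π * (b : GL (Fin n) F) := by
  obtain ⟨u, hu, b, hb, π, hπ⟩ := exists_reduced_columns g n le_rfl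
  have h : (u * g * b).1 = Matrix.of fun i j => if i = π j then 1 else 0 := by
    ext i j
    exact (hπ j j.2).1 i
  refine ⟨⟨u⁻¹, inv_mem hu⟩, π, ⟨b⁻¹, inv_mem hb⟩, ?_⟩
  have hex : ∃ w : GL (Fin n) F, w.1 = Matrix.of fun i j => if i = π j then 1 else 0 := ⟨_, h⟩
  have hw : (permElement π : GL (Fin n) F) = u * g * b := by
    rw [permElement, dif_pos hex]
    exact Units.ext (hex.choose_spec.trans h.symm)
  rw [hw]
  simp [mul_assoc]

end GeneralLinear

/-! ### Estimates for the general linear group -/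

section Estimates

open Filter Topology

theorem two_pow_le_card_gl (n : ℕ) (F : Type) [Field F] [Fintype F] :
    2 ^ (n * (n - 1)) ≤ Nat.card (Matrix.GeneralLinearGroup (Fin n) F) := by
  have hq : 2 ≤ Fintype.card F := Fintype.one_lt_card
  rw [Matrix.card_GL_field]
  calc 2 ^ (n * (n - 1)) = ∏ _i : Fin n, 2 ^ (n - 1) := by
        rw [Finset.prod_const, Finset.card_univ, Fintype.card_fin, ← pow_mul, mul_comm]
    _ ≤ _ := Finset.prod_le_prod' fun i _ => ?_
  have h1 : Fintype.card F ^ (i : ℕ) ≤ Fintype.card F ^ (n - 1) :=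
    Nat.pow_le_pow_right (by lia) (by lia)
  have h2 : 2 * Fintype.card F ^ (n - 1) ≤ Fintype.card F ^ n := by
    have : n = (n - 1) + 1 := by have := i.2; lia
    nth_rw 2 [this]
    rw [pow_succ, mul_comm]
    exact Nat.mul_le_mul_left _ hq
  have h3 : 2 ^ (n - 1) ≤ Fintype.card F ^ (n - 1) := Nat.pow_le_pow_left hq _
  lia

/-- Up to a constant, `n ^ (2 * n)` is smaller than any power of `2 ^ (n * (n - 1))`. -/
theorem exists_pow_le {η : ℝ} (hη : 0 < η) : ∃ C : ℝ, ∀ n : ℕ,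
    ((n : ℝ) ^ n) ^ 2 ≤ C * ((2 : ℝ) ^ (n * (n - 1))) ^ η := by
  have hr : (1 : ℝ) < 2 ^ η := Real.one_lt_rpow one_lt_two hη
  have hlim := tendsto_pow_const_div_const_pow_of_one_lt 2 hr
  have hev : ∀ᶠ n : ℕ in atTop, (n : ℝ) ^ 2 / (2 ^ η) ^ n < ((2 : ℝ) ^ η)⁻¹ :=
    hlim.eventually_lt_const (by positivity)
  obtain ⟨n₀, hn₀⟩ := eventually_atTop.1 hev
  refine ⟨1 + ∑ n ∈ Finset.range n₀, ((n : ℝ) ^ n) ^ 2, fun n => ?_⟩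
  have hS (s : Finset ℕ) : 0 ≤ ∑ n ∈ s, ((n : ℝ) ^ n) ^ 2 :=
    Finset.sum_nonneg fun _ _ => by positivity
  rcases Nat.lt_or_ge n n₀ with h | h
  · have h1 : 1 ≤ ((2 : ℝ) ^ (n * (n - 1))) ^ η :=
      Real.one_le_rpow (one_le_pow₀ one_le_two) hη.le
    have h2 := Finset.single_le_sum (f := fun n : ℕ => ((n : ℝ) ^ n) ^ 2)
      (fun _ _ => by positivity) (Finset.mem_range.2 h)
    nlinarith [hS (Finset.range n₀)]
  · refine le_trans ?_ (le_mul_of_one_le_left (by positivity)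
      (by linarith [hS (Finset.range n₀)]))
    rcases Nat.eq_zero_or_pos n with rfl | hn
    · simp
    have h1 : (n : ℝ) ^ 2 ≤ (2 ^ η) ^ (n - 1) := by
      have := (hn₀ n h).le
      rw [div_le_iff₀ (by positivity)] at this
      refine this.trans (le_of_eq ?_)
      obtain ⟨k, rfl⟩ : ∃ k, n = k + 1 := ⟨n - 1, by lia⟩
      rw [Nat.add_sub_cancel, pow_succ]
      field_simp
    calc ((n : ℝ) ^ n) ^ 2 = ((n : ℝ) ^ 2) ^ n := by rw [← pow_mul, ← pow_mul, mul_comm]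
      _ ≤ ((2 ^ η) ^ (n - 1)) ^ n := by gcongr
      _ = _ := by
        rw [← pow_mul, mul_comm (n - 1), Real.rpow_pow_comm zero_le_two]

/-- The double subgroup reduction for the unitriangular group and the Borel subgroup. -/
theorem MatMulBound.dftCost_gl {τ b : ℝ} (hb : MatMulBound τ b) (n : ℕ) (F : Type) [Field F]
    [Fintype F] [DecidableEq F] :
    DFTCost (Matrix.GeneralLinearGroup (Fin n) F) (((n : ℝ) ^ n) ^ 2 *
      (b * (216 * Real.logb 2 (Nat.card (Matrix.GeneralLinearGroup (Fin n) F)) + 112)) *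
        (Nat.card (Matrix.GeneralLinearGroup (Fin n) F) : ℝ) ^ (τ / 2)) := by
  have := Fintype.ofFinite (unipotent n F 0)
  have := Fintype.ofFinite (borel n F)
  have key := hb.dftCost_of_cover (φ := (unipotent n F 0).subtype) (ψ := (borel n F).subtype)
    (s := permElement) exists_bruhat ((dftBound_unipotent hb 0).dftCost hb)
    ((dftBound_borel hb).dftCost hb)
  intro ι d ρ hρ
  refine (key ι d ρ hρ).mono ?_
  simp only [← Nat.card_eq_fintype_card]
  have hW : ((Nat.card (Fin n → Fin n) : ℕ) : ℝ) = (n : ℝ) ^ n := by simp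
  rw [hW]
  have hUG := Subgroup.card_le_card_group (unipotent n F 0)
  have hBG := Subgroup.card_le_card_group (borel n F)
  have hUB := card_unipotent_mul_card_borel_le (n := n) (F := F)
  have hU1 := Nat.card_pos (α := unipotent n F 0)
  have hB1 := Nat.card_pos (α := borel n F)
  have hG1 := Nat.card_pos (α := Matrix.GeneralLinearGroup (Fin n) F)
  generalize Nat.card (unipotent n F 0) = u at *
  generalize Nat.card (borel n F) = v at *
  generalize Nat.card (Matrix.GeneralLinearGroup (Fin n) F) = g at *
  have hN : 1 ≤ (n : ℝ) ^ n := by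
    rcases Nat.eq_zero_or_pos n with rfl | hn
    · simp
    · exact one_le_pow₀ (by exact_mod_cast hn)
  generalize (n : ℝ) ^ n = N at *
  have hb1 := hb.one_le
  have hτ := hb.two_le
  have hu0 : (0 : ℝ) < u := by exact_mod_cast hU1
  have hv0 : (0 : ℝ) < v := by exact_mod_cast hB1
  have hL0 : 0 ≤ Real.logb 2 g := Real.logb_nonneg one_lt_two (by exact_mod_cast hG1)
  have hLu : Real.logb 2 u ≤ Real.logb 2 g :=
    Real.logb_le_logb_of_le one_lt_two hu0 (by exact_mod_cast hUG)
  have hLv : Real.logb 2 v ≤ Real.logb 2 g :=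
    Real.logb_le_logb_of_le one_lt_two hv0 (by exact_mod_cast hBG)
  have hg := self_le_rpow hG1 hτ
  have hu := self_le_rpow hU1 hτ
  have hv := self_le_rpow hB1 hτ
  have hX : ((u * v : ℕ) : ℝ) ^ (τ / 2) ≤ (g : ℝ) ^ (τ / 2) :=
    Real.rpow_le_rpow (by positivity) (by exact_mod_cast hUB) (by linarith)
  have hXuv : (u : ℝ) ^ (τ / 2) * (v : ℝ) ^ (τ / 2) ≤ (g : ℝ) ^ (τ / 2) := by
    rwa [Nat.cast_mul, Real.mul_rpow (by positivity) (by positivity)] at hX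
  set L := Real.logb 2 g
  set X := (g : ℝ) ^ (τ / 2)
  have hX0 : 0 ≤ X := by positivity
  have t1 : (v : ℝ) * (54 * b * (2 * Real.logb 2 u + 1) * (u : ℝ) ^ (τ / 2)) ≤
      54 * b * (2 * L + 1) * X := by
    calc _ = 54 * b * (2 * Real.logb 2 u + 1) * ((u : ℝ) ^ (τ / 2) * v) := by ring
      _ ≤ 54 * b * (2 * L + 1) * ((u : ℝ) ^ (τ / 2) * (v : ℝ) ^ (τ / 2)) := by gcongr
      _ ≤ _ := by gcongr
  have t2 : (u : ℝ) * (54 * b * (2 * Real.logb 2 v + 1) * (v : ℝ) ^ (τ / 2)) ≤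
      54 * b * (2 * L + 1) * X := by
    calc _ = 54 * b * (2 * Real.logb 2 v + 1) * (u * (v : ℝ) ^ (τ / 2)) := by ring
      _ ≤ 54 * b * (2 * L + 1) * ((u : ℝ) ^ (τ / 2) * (v : ℝ) ^ (τ / 2)) := by gcongr
      _ ≤ _ := by gcongr
  have hNN : N ≤ N ^ 2 := by nlinarith
  have hN2 : 1 ≤ N ^ 2 := by nlinarith
  have hbX : X ≤ b * X := le_mul_of_one_le_left hX0 hb1
  have hbX0 : 0 ≤ b * X := hX0.trans hbX
  have hD0 : 0 ≤ 54 * b * (2 * L + 1) * X := by positivity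
  calc _ ≤ N * (54 * b * (2 * L + 1) * X + 54 * b * (2 * L + 1) * X + N * b * X + b * X) +
        2 * b * X := by
        gcongr
        exact hg.trans hbX
    _ = N * (2 * (54 * b * (2 * L + 1) * X) + b * X) + N ^ 2 * (b * X) + 1 * (2 * (b * X)) := by
        ring
    _ ≤ N ^ 2 * (2 * (54 * b * (2 * L + 1) * X) + b * X) + N ^ 2 * (b * X) +
        N ^ 2 * (2 * (b * X)) := by gcongr
    _ = _ := by ring

/-- Logarithmic factors and `n ^ (2 * n)` are absorbed by an arbitrarily small power of the group
order. -/
theorem exists_dftCost_gl {ε : ℝ} (hε : 0 < ε) : ∃ c : ℝ, ∀ (n : ℕ) (F : Type) [Field F]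
    [Fintype F] [DecidableEq F], DFTCost (Matrix.GeneralLinearGroup (Fin n) F)
      (c * (Nat.card (Matrix.GeneralLinearGroup (Fin n) F) : ℝ) ^ (omega / 2 + ε)) := by
  obtain ⟨τ, b, hb, hτ⟩ := exists_matMulBound hε
  have hη : 0 < ε / 4 := by linarith
  obtain ⟨C, hC⟩ := exists_pow_le hη
  have hlog2 : 0 < Real.log 2 := Real.log_pos one_lt_two
  set D : ℝ := 1 / (ε / 4 * Real.log 2) with hD
  refine ⟨C * (b * (216 * D + 112)), fun n F _ _ _ ι d ρ hρ => (hb.dftCost_gl n F ι d ρ hρ).mono ?_⟩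
  have hcard := two_pow_le_card_gl n F
  have hG1 := Nat.card_pos (α := Matrix.GeneralLinearGroup (Fin n) F)
  generalize Nat.card (Matrix.GeneralLinearGroup (Fin n) F) = g at *
  have hg1 : (1 : ℝ) ≤ g := by exact_mod_cast hG1
  have hg0 : (0 : ℝ) < g := by linarith
  have hb0 : 0 ≤ b := by linarith [hb.one_le]
  have hD0 : 0 ≤ D := by positivity
  have hC0 : 0 ≤ C := by
    have := hC 0
    simp at this
    linarith
  have h1 : ((n : ℝ) ^ n) ^ 2 ≤ C * (g : ℝ) ^ (ε / 4) := by
    refine (hC n).trans ?_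
    gcongr
    exact_mod_cast hcard
  have hL : Real.logb 2 g ≤ D * (g : ℝ) ^ (ε / 4) := by
    have := Real.log_le_rpow_div hg0.le hη
    rw [Real.logb, hD, div_le_iff₀ hlog2]
    refine this.trans (le_of_eq ?_)
    field_simp
  have h2 : 216 * Real.logb 2 g + 112 ≤ (216 * D + 112) * (g : ℝ) ^ (ε / 4) := by
    have : 1 ≤ (g : ℝ) ^ (ε / 4) := Real.one_le_rpow hg1 hη.le
    nlinarith
  have hL0 : 0 ≤ Real.logb 2 g := Real.logb_nonneg one_lt_two hg1
  calc _ ≤ C * (g : ℝ) ^ (ε / 4) * (b * ((216 * D + 112) * (g : ℝ) ^ (ε / 4))) *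
        (g : ℝ) ^ (τ / 2) := by gcongr
    _ = C * (b * (216 * D + 112)) *
        ((g : ℝ) ^ (ε / 4) * (g : ℝ) ^ (ε / 4) * (g : ℝ) ^ (τ / 2)) := by ring
    _ ≤ _ := by
        rw [← Real.rpow_add hg0, ← Real.rpow_add hg0]
        exact mul_le_mul_of_nonneg_left
          (Real.rpow_le_rpow_of_exponent_le hg1 (by linarith)) (by positivity)

end Estimates

end GenDFT

theorem theorem5p3 (ε : ℝ) (hε : 0 < ε) :
    ∃ c : ℝ, ∀ (n : ℕ) (F : Type) [Field F] [Fintype F] [DecidableEq F],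
      (∃ (ι : Type) (d : ι → ℕ)
          (ρ : ∀ i, Matrix.GeneralLinearGroup (Fin n) F →* Matrix (Fin (d i)) (Fin (d i)) ℂ),
          GenDFT.IsCompleteIrreps ρ) ∧
      ∀ (ι : Type) (d : ι → ℕ)
        (ρ : ∀ i, Matrix.GeneralLinearGroup (Fin n) F →* Matrix (Fin (d i)) (Fin (d i)) ℂ),
        GenDFT.IsCompleteIrreps ρ →
        ∃ C : GenDFT.Circuit ℂ (Matrix.GeneralLinearGroup (Fin n) F)
            (Σ i, Fin (d i) × Fin (d i)),
          C.Computes (GenDFT.dft ρ) ∧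
          (C.size : ℝ) ≤
            c * (Nat.card (Matrix.GeneralLinearGroup (Fin n) F) : ℝ) ^
              (GenDFT.omega / 2 + ε) := by
  obtain ⟨c, hc⟩ := GenDFT.exists_dftCost_gl hε
  exact ⟨c, fun n F _ _ _ => ⟨GenDFT.exists_isCompleteIrreps _,
    fun ι d ρ hρ => (hc n F ι d ρ hρ).exists_circuit⟩⟩
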